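/- **Setting.** Fix integers $d,p$ and let $Z=(Z_1,\dots,Z_p)^{T}$ be a random field on $\mathbb R^d$ whose coordinates $Z_1,\dots,Z_p$ are independent stationary Gaussian processes with $E\{Z(s)\}=0$, $\operatorname{cov}\{Z(s)\}=I_p$ and $\operatorname{cov}\{Z_k(x),Z_k(y)\}=K_k(x-y)$. Let $X=\Omega Z$ with $\Omega$ a fixed invertible $p\times p$ matrix. For each $n$, let $s_1,\dots,s_n\in\mathbb R^d$ be observation points (which may change with $n$) such that, for a fixed $\Delta>0$, $\|s_i-s_j\|\ge\Delta$ for all $n$ and all $i\ne j$. Let $f:\mathbb R^d\to\mathbb R$ satisfy $f(s_i-s_j)=f(s_j-s_i)$ for all $n,i,j$ (for instance, $f$ even), and suppose that, for fixed $A>0$ and $\alpha>0$, $|K_k(x)|\le A/(1+\|x\|^{d+\alpha})$ and $|f(x)|\le A/(1+\|x\|^{d+\alpha})$ for all $x\in\mathbb R^d$ and $k=1,\dots,p$. Put $f_0(x)=I(x=0)$ and, for $g\in\{f_0,f\}$, $$\widehat M(g)=n^{-1}\sum_{i,j=1}^n g(s_i-s_j)X(s_i)X(s_j)^{T},\qquad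 M(g)=n^{-1}\sum_{i,j=1}^n g(s_i-s_j)E\{X(s_i)X(s_j)^{T}\}.$$ Say that $(\Gamma,\Lambda)$ jointly diagonalizes $(M_0,M)$ if $\Gamma M_0\Gamma^{T}=I_p$ and $\Gamma M\Gamma^{T}=\Lambda$, where $\Lambda$ is a diagonal matrix with diagonal elements in decreasing order. Let $\Lambda(f)$ be the diagonal matrix $\Lambda$ in a joint diagonalization of $(M(f_0),M(f))$; estimators $\widehat\Gamma(f),\widehat\Lambda(f)$ are a choice of a joint diagonalization of $(\widehat M(f_0),\widehat M(f))$ (whenever one exists; otherwise they are arbitrary). Let $\lambda_1,\dots,\lambda_p$ be the diagonal elements of $\Omega^{-1}M(f)\Omega^{-T}$ (they depend on $n$) and assume $$\liminf_{n\to\infty}\ \min_{i=2,\dots,p}\,(\lambda_{i-1}-\lambda_i)>0 .$$ **Matrices.** Index the coordinates of $\mathbb R^{p^2}$ by pairs $(i,j)$, $1\le i,j\le p$, in the row order of $\mathrm{vect}$ (row vectorization). Let $R_z$ be the $np\times np$ covariance matrix of the vector of all $Z_k(s_i)$, ordered with $(i,k)\mapsto(i-1)p+k$, and let $T_{b,l}(g)$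 be the $np\times np$ matrix whose $p\times p$ block $(i,j)$ is $g(s_i-s_j)\tfrac12(e_be_l^{T}+e_le_b^{T})$. Let $\Sigma(g,h)$ be the $p^2\times p^2$ matrix with entries $\Sigma(g,h)_{(s,t),(u,v)}=2n^{-1}\operatorname{tr}\{R_zT_{s,t}(g)R_zT_{u,v}(h)\}$, and $$\tilde V=\begin{pmatrix}\Sigma(f_0,f_0)&\Sigma(f_0,f)\\ \Sigma(f,f_0)&\Sigma(f,f)\end{pmatrix},\qquad G=\begin{pmatrix}A'&B'\\ C'&D'\end{pmatrix}.$$ Here $A',B'$ are diagonal $p^2\times p^2$ matrices, with $A'_{(i,i),(i,i)}=-\tfrac12$, $B'_{(i,i),(i,i)}=0$ and, for $i\ne j$, $A'_{(i,j),(i,j)}=-\lambda_i(\lambda_i-\lambda_j)^{-1}$, $B'_{(i,j),(i,j)}=(\lambda_i-\lambda_j)^{-1}$; and $C',D'$ are the $p\times p^2$ matrices whose only nonzero entries are $C'_{i,(i,i)}=-\lambda_i$ and $D'_{i,(i,i)}=1$. Let $\bar M=\begin{pmatrix}M_{\Omega^{-1}}&0\\0&I_p\end{pmatrix}$, where $(M_{\Omega^{-1}})_{(i,j),(k,l)}=(\Omega^{-1})_{l,j}$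 if $i=k$ and $0$ otherwise. Put $$F_1=\bar M\,G\,\tilde V\,G^{T}\bar M^{T},$$ a $(p^2+p)\times(p^2+p)$ matrix depending on $n$ (for the finitely many $n$ for which the $\lambda_i$ are not all distinct, read $0^{-1}=0$). **Claim.** $F_1$ is positive semidefinite; the probability that $(\widehat M(f_0),\widehat M(f))$ can be jointly diagonalized tends to $1$ as $n\to\infty$; and $\widehat\Gamma(f),\widehat\Lambda(f)$ can be chosen, as Borel measurable functions of $(\widehat M(f_0),\widehat M(f))$, so that, with $Q_n$ the distribution of $$n^{1/2}\begin{pmatrix}\mathrm{vect}\{\widehat\Gamma(f)-\Omega^{-1}\}\\ \mathrm{diag}\{\widehat\Lambda(f)-\Lambda(f)\}\end{pmatrix},$$ one has $d_w\{Q_n,\mathcal N(0,F_1)\}\to0$ as $n\to\infty$, for every metric $d_w$ generating the topology of weak convergence on the set of Borel probability measures on $\mathbb R^{p^2+p}$. -/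

import Mathlib

open MeasureTheory ProbabilityTheory Filter Topology

noncomputable section

namespace SpatialBSS

/-- The space `ℝ^d` of locations, with its Euclidean norm. -/
abbrev Loc (d : ℕ) : Type := EuclideanSpace ℝ (Fin d)

/-- Positions `(i, j)` in a `p × p` matrix. The row vectorisation of a `p × p` matrix is the vector
indexed by these positions: the coordinate number `(i - 1) p + j` is the one with index `(i, j)`. -/
abbrev Pos (p : ℕ) : Type := Fin p × Fin p

/-- The space `ℝ^(p² + p)` of pairs (vectorised matrix, diagonal). -/
abbrev VecDiag (p : ℕ) : Type := EuclideanSpace ℝ (Pos p ⊕ Fin p)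

/-- The kernel `f₀(x) = I(x = 0)`. -/
def kernelZero (d : ℕ) : Loc d → ℝ := Set.indicator {0} (fun _ => 1)

/-- The mixed field `X(x) = Ω Z(x)`. -/
def mix {Ω : Type*} {d p : ℕ} (Om : Matrix (Fin p) (Fin p) ℝ) (Z : Fin p → Loc d → Ω → ℝ)
    (x : Loc d) (ω : Ω) : Fin p → ℝ :=
  Om.mulVec (fun k => Z k x ω)

/-- The empirical local covariance matrix `n⁻¹ ∑ᵢ ∑ⱼ f(sᵢ - sⱼ) X(sᵢ) X(sⱼ)ᵀ`. -/
def empCov {Ω : Type*} {d p n : ℕ} (s : Fin n → Loc d) (f : Loc d → ℝ)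
    (X : Loc d → Ω → Fin p → ℝ) (ω : Ω) : Matrix (Fin p) (Fin p) ℝ :=
  (n : ℝ)⁻¹ • ∑ i, ∑ j, f (s i - s j) • Matrix.vecMulVec (X (s i) ω) (X (s j) ω)

/-- The population local covariance matrix `n⁻¹ ∑ᵢ ∑ⱼ f(sᵢ - sⱼ) E{X(sᵢ) X(sⱼ)ᵀ}`. -/
def popCov {Ω : Type*} [MeasurableSpace Ω] (P : Measure Ω) {d p n : ℕ} (s : Fin n → Loc d)
    (f : Loc d → ℝ) (X : Loc d → Ω → Fin p → ℝ) : Matrix (Fin p) (Fin p) ℝ :=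
  (n : ℝ)⁻¹ • ∑ i, ∑ j, f (s i - s j) •
    Matrix.of (fun a b => ∫ ω, X (s i) ω a * X (s j) ω b ∂P)

/-- `Γ` jointly diagonalises `M₀` and `M`: `Γ M₀ Γᵀ = I` and `Γ M Γᵀ = Λ`, where `Λ` is diagonal
with diagonal elements in decreasing order. -/
structure IsUnmixing {p : ℕ} (M₀ M Γ Λ : Matrix (Fin p) (Fin p) ℝ) : Prop where
  whiten : Γ * M₀ * Γ.transpose = 1
  diagonalise : Γ * M * Γ.transpose = Λ
  isDiag : Λ.IsDiag
  decreasing : ∀ i j : Fin p, i ≤ j → Λ j j ≤ Λ i i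

/-- `R_z`, the covariance matrix of the vector of all `Z_k(s_i)`, indexed by `(i, k)`. -/
def latentCov {Ω : Type*} [MeasurableSpace Ω] (P : Measure Ω) {d p n : ℕ} (s : Fin n → Loc d)
    (Z : Fin p → Loc d → Ω → ℝ) : Matrix (Fin n × Fin p) (Fin n × Fin p) ℝ :=
  Matrix.of fun a b => cov[Z a.2 (s a.1), Z b.2 (s b.1); P]

/-- `T_{b,l}(f)`: the block matrix whose block `(i, j)` is
`f(sᵢ - sⱼ) (1/2) (e_b e_lᵀ + e_l e_bᵀ)`. -/
def blockT {d p n : ℕ} (s : Fin n → Loc d) (f : Loc d → ℝ) (b l : Fin p) :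
    Matrix (Fin n × Fin p) (Fin n × Fin p) ℝ :=
  Matrix.of fun x y => f (s x.1 - s y.1) *
    ((1 / 2 : ℝ) • (Matrix.single b l (1 : ℝ) + Matrix.single l b (1 : ℝ))) x.2 y.2

/-- `Σ(f, g)`, with entries `2 n⁻¹ tr{R T_{s,t}(f) R T_{u,v}(g)}`. -/
def sigmaMat {d p n : ℕ} (R : Matrix (Fin n × Fin p) (Fin n × Fin p) ℝ) (s : Fin n → Loc d)
    (f g : Loc d → ℝ) : Matrix (Pos p) (Pos p) ℝ :=
  Matrix.of fun a b => 2 * (n : ℝ)⁻¹ *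
    (R * blockT s f a.1 a.2 * R * blockT s g b.1 b.2).trace

/-- `V(f, g)`, with blocks `Σ(f, f)`, `Σ(f, g)`, `Σ(g, f)`, `Σ(g, g)`. -/
def vMat {d p n : ℕ} (R : Matrix (Fin n × Fin p) (Fin n × Fin p) ℝ) (s : Fin n → Loc d)
    (f g : Loc d → ℝ) : Matrix (Pos p ⊕ Pos p) (Pos p ⊕ Pos p) ℝ :=
  Matrix.fromBlocks (sigmaMat R s f f) (sigmaMat R s f g) (sigmaMat R s g f) (sigmaMat R s g g)

/-- The `p² × p²` diagonal matrix `A`. -/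
def gA {p : ℕ} (lam : Fin p → ℝ) : Matrix (Pos p) (Pos p) ℝ :=
  Matrix.diagonal fun a =>
    if a.1 = a.2 then -(1 / 2) else -(lam a.1) * (lam a.1 - lam a.2)⁻¹

/-- The `p² × p²` diagonal matrix `B`. -/
def gB {p : ℕ} (lam : Fin p → ℝ) : Matrix (Pos p) (Pos p) ℝ :=
  Matrix.diagonal fun a => if a.1 = a.2 then 0 else (lam a.1 - lam a.2)⁻¹

/-- The `p × p²` matrix `C`. -/
def gC {p : ℕ} (lam : Fin p → ℝ) : Matrix (Fin p) (Pos p) ℝ :=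
  Matrix.of fun i a => if a = (i, i) then -(lam i) else 0

/-- The `p × p²` matrix `D`. -/
def gD (p : ℕ) : Matrix (Fin p) (Pos p) ℝ :=
  Matrix.of fun i a => if a = (i, i) then 1 else 0

/-- `G`, with blocks `A`, `B`, `C`, `D`. -/
def gMat {p : ℕ} (lam : Fin p → ℝ) : Matrix (Pos p ⊕ Fin p) (Pos p ⊕ Pos p) ℝ :=
  Matrix.fromBlocks (gA lam) (gB lam) (gC lam) (gD p)

/-- For `W = Ω⁻¹`, the `p² × p²` matrix `M_W`, of the map `vect(H) ↦ vect(H W)`. -/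
def mMat {p : ℕ} (W : Matrix (Fin p) (Fin p) ℝ) : Matrix (Pos p) (Pos p) ℝ :=
  Matrix.of fun a b => if a.1 = b.1 then W b.2 a.2 else 0

/-- For `W = Ω⁻¹`, the block diagonal matrix with blocks `M_W` and `I_p`. -/
def mBar {p : ℕ} (W : Matrix (Fin p) (Fin p) ℝ) : Matrix (Pos p ⊕ Fin p) (Pos p ⊕ Fin p) ℝ :=
  Matrix.fromBlocks (mMat W) 0 0 1

/-- The diagonal elements `λ₁, …, λ_p` of `Ω⁻¹ M(f) Ω⁻ᵀ`. -/
def lamPop {Ω : Type*} [MeasurableSpace Ω] (P : Measure Ω) {d p n : ℕ} (s : Fin n → Loc d)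
    (f : Loc d → ℝ) (Om : Matrix (Fin p) (Fin p) ℝ) (Z : Fin p → Loc d → Ω → ℝ) (i : Fin p) : ℝ :=
  (Om⁻¹ * popCov P s f (mix Om Z) * (Om⁻¹).transpose) i i

/-- `F₁ = M̄ G Ṽ Gᵀ M̄ᵀ`, where `Ṽ` is `V(f₀, f)` formed with `R_z`. -/
def covF {Ω : Type*} [MeasurableSpace Ω] (P : Measure Ω) {d p n : ℕ} (s : Fin n → Loc d)
    (f : Loc d → ℝ) (Om : Matrix (Fin p) (Fin p) ℝ) (Z : Fin p → Loc d → Ω → ℝ) :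
    Matrix (Pos p ⊕ Fin p) (Pos p ⊕ Fin p) ℝ :=
  mBar Om⁻¹ * gMat (lamPop P s f Om Z) * vMat (latentCov P s Z) s (kernelZero d) f *
    (gMat (lamPop P s f Om Z)).transpose * (mBar Om⁻¹).transpose

/-- The vector `n^{1/2} (vect H, diag L)`. -/
def scaledVecDiag {p : ℕ} (n : ℕ) (H L : Matrix (Fin p) (Fin p) ℝ) : VecDiag p :=
  WithLp.toLp 2 (Sum.elim (fun a => √(n : ℝ) * H a.1 a.2) (fun i => √(n : ℝ) * L i i))

/-- The centred normal distribution with covariance matrix `S`. -/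
def normalLaw {p : ℕ} (S : Matrix (Pos p ⊕ Fin p) (Pos p ⊕ Fin p) ℝ) :
    ProbabilityMeasure (VecDiag p) :=
  ⟨multivariateGaussian 0 S, inferInstance⟩

/-- `d_w(Q_n, N_n) → 0` for every metric `d_w` generating the topology of weak convergence on the
set of Borel probability measures. -/
def AsympClose {p : ℕ} (Q N : ℕ → ProbabilityMeasure (VecDiag p)) : Prop :=
  ∀ dw : MetricSpace (ProbabilityMeasure (VecDiag p)),
    dw.toPseudoMetricSpace.toUniformSpace.toTopologicalSpace =
      (inferInstance : TopologicalSpace (ProbabilityMeasure (VecDiag p))) →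
    Tendsto (fun n => dw.dist (Q n) (N n)) atTop (𝓝 0)

/-- Joint Borel measurability of a map taking two matrices to a matrix. -/
def MatMeasurable {p : ℕ}
    (g : Matrix (Fin p) (Fin p) ℝ → Matrix (Fin p) (Fin p) ℝ → Matrix (Fin p) (Fin p) ℝ) : Prop :=
  Measurable fun q : (Fin p → Fin p → ℝ) × (Fin p → Fin p → ℝ) =>
    (fun i j => g (Matrix.of q.1) (Matrix.of q.2) i j : Fin p → Fin p → ℝ)

end SpatialBSS

end

/-!
# Asymptotic normality of the joint diagonalisation of local covariance matrices

Multiplying by `Ω⁻¹` turns a joint diagonalisation `Γ` of the empirical matrices of `X` into a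
joint diagonalisation `Γ Ω` of those of the latent field `Z` (`IsUnmixing.congr_basis`). For `Z`
the population matrices are `I` and `diag(λ₁, …, λ_p)`, and the aim is to expand `Γ Ω` around `I`.

*The empirical matrices.* Their entries are quadratic forms in the Gaussian vector of all
`Z_k(sᵢ)`. In an eigenbasis, a linear combination of them is a weighted sum of independent
variables `x² - 1`, with weights the eigenvalues of `R^{1/2} S R^{1/2}`, where `R` is the
covariance matrix and `S` the matrix of the form. By the decay of `K` and `f` and the separation of
the points, the row sums of `|R|` and `|S|` are bounded in `n`
(`exists_sum_inv_one_add_norm_rpow_le`), so that no eigenvalue dominates and the characteristic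
function of the normalised error differs from the Gaussian one with covariance matrix `V` by a null
sequence (`quadratic_charFun_sub_exp_le`, `tendsto_charFun_errVec_sub`).

*The diagonalisation.* If `M₀ → I` and `M → diag λ` with separated `λ`, then the joint diagonaliser
with nonnegative diagonal tends to `I`. The relation `Γ M = Λ Γ M₀` then gives its first order
expansion, with derivative given by `G` (`tendsto_deriv_of_isUnmixing`, `mBar_mul_gMat_mulVec`).
Along ultrafilters this expansion is uniform over bounded normalised errors
(`eventually_norm_scaledVecDiag_sub_le`).

*Conclusion.* The eigenvalues `λ` and the matrix `V` are bounded, so every sequence of indices has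
a subsequence along which both converge. There the normalised errors converge in law by Lévy's
theorem, and the delta method (`tendsto_law_of_linearisation`) and the continuity of the normal law
in its covariance matrix (`tendsto_normalLaw`) give the same limit for `Q n` and the normal laws.
Hence their distance tends to zero for each metric of the weak topology. The positive definiteness
of the first empirical matrix, hence the existence of a joint diagonalisation, has probability
tending to one since the errors are tight (`tendsto_measure_one`).

*Measurability.* The set of triples `(M₀, M, Γ)` with `Γ` a joint diagonaliser is closed, and a
closed subset of a product with `ℝᵐ` has a Borel selector (`exists_measurable_selection`).
-/

namespace SpatialBSS

/-! ### Measurable selection from closed sets -/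

section Selection

universe u

/-- Projecting a closed set whose fibres lie in one ball gives a closed set, as the projection
along a compact factor is closed. -/
lemma isClosed_proj {X : Type u} [TopologicalSpace X] {m : ℕ} {K : Set (X × (Fin m → ℝ))}
    (hK : IsClosed K) {N : ℝ} (hN : ∀ q ∈ K, ‖q.2‖ ≤ N) : IsClosed {x | ∃ y, (x, y) ∈ K} := by
  have hc : CompactSpace (Metric.closedBall (0 : Fin m → ℝ) N) :=
    isCompact_iff_compactSpace.mp (isCompact_closedBall _ _)
  have h1 : IsClosed {q : X × Metric.closedBall (0 : Fin m → ℝ) N | (q.1, (q.2 : Fin m → ℝ)) ∈ K} :=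
    hK.preimage (by fun_prop)
  convert isClosedMap_fst_of_compactSpace _ h1 using 1
  ext x
  constructor
  · rintro ⟨y, hy⟩
    exact ⟨(x, ⟨y, by simpa using hN _ hy⟩), hy, rfl⟩
  · rintro ⟨⟨x', y⟩, hy, rfl⟩
    exact ⟨y, hy⟩

/-- A closed set with uniformly bounded fibres has a Borel selector: the lexicographic minimum.
The first coordinate is minimised, and its value becomes an additional parameter for the choice of
the remaining ones, so that the set to select from stays closed. -/
lemma exists_measurable_selection_of_bounded (m : ℕ) : ∀ (X : Type u) [TopologicalSpace X]
    [MeasurableSpace X] [BorelSpace X] (K : Set (X × (Fin m → ℝ))), IsClosed K →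
    ∀ N : ℝ, (∀ q ∈ K, ‖q.2‖ ≤ N) →
    ∃ sel : X → (Fin m → ℝ), Measurable sel ∧ ∀ x, (∃ y, (x, y) ∈ K) → (x, sel x) ∈ K := by
  induction m with
  | zero =>
    intro X _ _ _ K _ N _
    refine ⟨fun _ => 0, measurable_const, ?_⟩
    rintro x ⟨y, hy⟩
    rwa [Subsingleton.elim y 0] at hy
  | succ m ih =>
    intro X _ _ _ K hK N hN
    let V : X → Set ℝ := fun x => {t | ∃ y, (x, y) ∈ K ∧ y 0 = t}
    let g : X → ℝ := fun x => sInf (V x)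
    have hVc : ∀ x, IsCompact (V x) := by
      intro x
      have h1 : IsCompact {y | (x, y) ∈ K} := by
        refine (isCompact_closedBall (0 : Fin (m + 1) → ℝ) N).of_isClosed_subset
          (hK.preimage (by fun_prop)) ?_
        intro y hy
        simpa using hN _ hy
      exact h1.image (f := fun y => y 0) (by fun_prop)
    have hg : ∀ x, (∃ y, (x, y) ∈ K) → g x ∈ V x := by
      rintro x ⟨y, hy⟩
      exact (hVc x).sInf_mem ⟨y 0, y, hy, rfl⟩
    have hgm : Measurable g := by
      refine measurable_of_Iic fun c => ?_
      have h1 : IsClosed {x | ∃ y, (x, y) ∈ K ∩ {q | q.2 0 ≤ c}} :=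
        isClosed_proj (hK.inter (isClosed_le (by fun_prop) (by fun_prop)))
          (fun q hq => hN q hq.1)
      have h2 := isClosed_proj hK hN
      have h3 : g ⁻¹' Set.Iic c = {x | ∃ y, (x, y) ∈ K ∩ {q | q.2 0 ≤ c}} ∪
          ({x | ∃ y, (x, y) ∈ K}ᶜ ∩ {_x | (0 : ℝ) ≤ c}) := by
        ext x
        by_cases hx : ∃ y, (x, y) ∈ K
        · have h4 : g x ≤ c ↔ ∃ y, (x, y) ∈ K ∧ y 0 ≤ c := by
            constructor
            · intro h
              obtain ⟨y, hy, hy'⟩ := hg x hx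
              exact ⟨y, hy, hy' ▸ h⟩
            · rintro ⟨y, hy, hy'⟩
              exact (csInf_le (hVc x).bddBelow ⟨y, hy, rfl⟩).trans hy'
          simp only [Set.mem_preimage, Set.mem_Iic, h4, Set.mem_union, Set.mem_inter_iff,
            Set.mem_compl_iff, Set.mem_ofPred_eq, hx, not_true_eq_false, false_and, or_false]
        · have h4 : V x = ∅ := by
            ext t
            simp only [V, Set.mem_ofPred_eq, Set.mem_empty_iff_false, iff_false]
            rintro ⟨y, hy, -⟩
            exact hx ⟨y, hy⟩
          have h5 : g x = 0 := by simp [g, h4]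
          have h6 : ¬ ∃ y, (x, y) ∈ K ∧ y 0 ≤ c := fun ⟨y, hy, _⟩ => hx ⟨y, hy⟩
          simp only [Set.mem_preimage, Set.mem_Iic, h5, Set.mem_union, Set.mem_inter_iff,
            Set.mem_compl_iff, Set.mem_ofPred_eq, hx, not_false_eq_true, true_and, h6, false_or]
      rw [h3]
      exact h1.measurableSet.union (h2.measurableSet.compl.inter (MeasurableSet.const _))
    obtain ⟨sel, hsm, hs⟩ := ih (X × ℝ)
      {q | (q.1.1, (Fin.cons q.1.2 q.2 : Fin (m + 1) → ℝ)) ∈ K}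
      (hK.preimage (by fun_prop)) N (by
        intro q hq
        refine le_trans ?_ (hN _ hq)
        refine (pi_norm_le_iff_of_nonneg (norm_nonneg _)).2 fun i => ?_
        have := norm_le_pi_norm (Fin.cons q.1.2 q.2 : Fin (m + 1) → ℝ) i.succ
        simpa using this)
    refine ⟨fun x => Fin.cons (g x) (sel (x, g x)), ?_, ?_⟩
    · refine measurable_pi_iff.2 fun i => ?_
      refine Fin.cases ?_ (fun j => ?_) i
      · simpa using hgm
      · have := (measurable_pi_apply j).comp (hsm.comp (measurable_id.prodMk hgm))
        simpa [Function.comp_def] using this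
    · intro x hx
      obtain ⟨y, hy, hy'⟩ := hg x hx
      refine hs (x, g x) ⟨Fin.tail y, ?_⟩
      simp only [Set.mem_ofPred_eq]
      rw [← hy', Fin.cons_self_tail]
      exact hy

/-- A closed subset of `X × ℝᵐ` has a Borel selector. The fibre over a point is cut off by the
smallest ball of integral radius that meets it. -/
lemma exists_measurable_selection {X : Type u} [TopologicalSpace X] [MeasurableSpace X]
    [BorelSpace X] {m : ℕ} {K : Set (X × (Fin m → ℝ))} (hK : IsClosed K) :
    ∃ sel : X → (Fin m → ℝ), Measurable sel ∧ ∀ x, (∃ y, (x, y) ∈ K) → (x, sel x) ∈ K := by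
  classical
  let KN : ℕ → Set (X × (Fin m → ℝ)) := fun N => K ∩ {q | ‖q.2‖ ≤ N}
  have hKN : ∀ N, IsClosed (KN N) := fun N =>
    hK.inter (isClosed_le (by fun_prop) (by fun_prop))
  have hD : ∀ N : ℕ, IsClosed {x | ∃ y, (x, y) ∈ KN N} := fun N =>
    isClosed_proj (hKN N) (N := N) fun q hq => hq.2
  choose sel hsm hs using fun N : ℕ =>
    exists_measurable_selection_of_bounded m X (KN N) (hKN N) N fun q hq => hq.2
  let p : ℕ → X → Prop := fun N x => (∃ y, (x, y) ∈ KN N) ∨ ∀ N, ¬ ∃ y, (x, y) ∈ KN N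
  have hp : ∀ N, MeasurableSet {x | p N x} := by
    intro N
    have h1 : {x | p N x} = {x | ∃ y, (x, y) ∈ KN N} ∪ ⋂ M, {x | ∃ y, (x, y) ∈ KN M}ᶜ := by
      ext x
      simp only [p, Set.mem_ofPred_eq, Set.mem_union, Set.mem_iInter, Set.mem_compl_iff]
    rw [h1]
    exact (hD N).measurableSet.union
      (MeasurableSet.iInter fun M => (hD M).measurableSet.compl)
  have hex : ∀ x, ∃ N, p N x := by
    intro x
    by_cases h : ∃ N, ∃ y, (x, y) ∈ KN N
    · obtain ⟨N, h⟩ := h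
      exact ⟨N, Or.inl h⟩
    · exact ⟨0, Or.inr fun N hN => h ⟨N, hN⟩⟩
  refine ⟨fun x => sel (Nat.find (hex x)) x, Measurable.find hsm hp hex, ?_⟩
  rintro x ⟨y, hy⟩
  have h0 : ∃ z, (x, z) ∈ KN ⌈‖y‖⌉₊ := ⟨y, hy, by simpa using Nat.le_ceil ‖y‖⟩
  rcases Nat.find_spec (hex x) with h | h
  · exact (hs _ x h).1
  · exact absurd h0 (h ⌈‖y‖⌉₊)

end Selection

/-! ### Joint diagonalisation of two matrices -/

section Unmixing

open Matrix

variable {p : ℕ} {M₀ M Gam L : Matrix (Fin p) (Fin p) ℝ}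

lemma IsUnmixing.transpose_mul_mul (h : IsUnmixing M₀ M Gam L) : Gamᵀ * Gam * M₀ = 1 := by
  rw [Matrix.mul_assoc]
  exact mul_eq_one_comm.1 h.whiten

lemma IsUnmixing.mul_eq (h : IsUnmixing M₀ M Gam L) : Gam * M = L * Gam * M₀ := by
  rw [← h.diagonalise]
  calc Gam * M = Gam * M * (Gamᵀ * Gam * M₀) := by rw [h.transpose_mul_mul, Matrix.mul_one]
    _ = _ := by simp only [Matrix.mul_assoc]

lemma IsUnmixing.eq_diagonal (h : IsUnmixing M₀ M Gam L) : L = diagonal fun i => L i i := by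
  ext i j
  by_cases hij : i = j
  · subst hij; simp
  · rw [diagonal_apply_ne _ hij]; exact h.isDiag hij

/-- The rows of `Γ` are eigenvectors of a diagonal matrix with distinct eigenvalues, hence multiples
of coordinate vectors; the order of the eigenvalues excludes any permutation. -/
lemma IsUnmixing.apply_of_one {lam : Fin p → ℝ} (hlam : StrictAnti lam)
    (h : IsUnmixing 1 (diagonal lam) Gam L) :
    (∀ i j, i ≠ j → Gam i j = 0) ∧ L = diagonal lam ∧ ∀ i, Gam i i ^ 2 = 1 := by
  have h1 : ∀ i j, Gam i j * lam j = L i i * Gam i j := by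
    intro i j
    have := congrFun (congrFun h.mul_eq i) j
    rw [h.eq_diagonal] at this
    simpa using this
  have h2 : ∀ i k, ∑ j, Gam i j * Gam k j = if i = k then 1 else 0 := by
    intro i k
    have := congrFun (congrFun h.whiten i) k
    simpa [Matrix.mul_apply, Matrix.one_apply] using this
  have h3 : ∀ i, ∃ j, Gam i j ≠ 0 := by
    intro i
    by_contra! hc
    have := h2 i i
    simp [hc] at this
  choose σ hσ using h3
  have h4 : ∀ i, L i i = lam (σ i) := fun i =>
    (mul_right_cancel₀ (hσ i) (by rw [← h1 i (σ i)]; ring)).symm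
  have h5 : ∀ i j, j ≠ σ i → Gam i j = 0 := by
    intro i j hj
    by_contra hc
    have := mul_right_cancel₀ hc ((h1 i j).symm.trans (mul_comm _ _))
    rw [h4 i] at this
    exact hj (hlam.injective this.symm)
  have h6 : StrictMono σ := by
    intro i k hik
    refine lt_of_le_of_ne ?_ ?_
    · have := h.decreasing i k hik.le
      rw [h4, h4] at this
      exact hlam.le_iff_ge.1 this
    · intro he
      have := h2 i k
      rw [Finset.sum_eq_single (σ i) (fun j _ hj => by rw [h5 i j hj, zero_mul]) (by simp),
        if_neg hik.ne] at this
      rcases mul_eq_zero.1 this with h | h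
      · exact hσ i h
      · rw [he] at h; exact hσ k h
  have h7 : σ = id := h6.eq_id
  simp only [h7, id] at h4 h5
  refine ⟨fun i j hij => h5 i j hij.symm, ?_, fun i => ?_⟩
  · rw [h.eq_diagonal]; simp only [h4]
  · have := h2 i i
    rw [Finset.sum_eq_single i (fun j _ hj => by rw [h5 i j hj, zero_mul]) (by simp)] at this
    simpa [sq] using this

lemma IsUnmixing.eq_one_of_one {lam : Fin p → ℝ} (hlam : StrictAnti lam)
    (h : IsUnmixing 1 (diagonal lam) Gam L) (h0 : ∀ i, 0 ≤ Gam i i) : Gam = 1 := by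
  obtain ⟨h1, -, h2⟩ := h.apply_of_one hlam
  ext i j
  by_cases hij : i = j
  · subst hij
    rw [one_apply_eq]
    exact (pow_eq_one_iff_of_nonneg (h0 i) two_ne_zero).1 (h2 i)
  · rw [one_apply_ne hij, h1 i j hij]

lemma exists_orthogonal_diagonal {ι : Type*} [Fintype ι] [DecidableEq ι] {S : Matrix ι ι ℝ}
    (hS : S.IsHermitian) : ∃ U : Matrix ι ι ℝ, U * Uᵀ = 1 ∧ Uᵀ * U = 1 ∧
      U * S * Uᵀ = diagonal hS.eigenvalues := by
  set V : Matrix ι ι ℝ := (hS.eigenvectorUnitary : Matrix ι ι ℝ) with hV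
  have h1 : Vᵀ * V = 1 := by
    have := (Unitary.mem_iff.1 hS.eigenvectorUnitary.2).1
    rwa [star_eq_conjTranspose, conjTranspose_eq_transpose_of_trivial] at this
  have h2 : V * Vᵀ = 1 := mul_eq_one_comm.1 h1
  have h3 : S = V * diagonal hS.eigenvalues * Vᵀ := by
    have := hS.spectral_theorem
    rw [Unitary.conjStarAlgAut_apply, star_eq_conjTranspose,
      conjTranspose_eq_transpose_of_trivial] at this
    exact this
  refine ⟨Vᵀ, by simpa using h1, by simpa using h2, ?_⟩
  conv_lhs => rw [h3]
  rw [transpose_transpose]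
  calc Vᵀ * (V * diagonal hS.eigenvalues * Vᵀ) * V
      = (Vᵀ * V) * diagonal hS.eigenvalues * (Vᵀ * V) := by simp only [Matrix.mul_assoc]
    _ = _ := by rw [h1]; simp

/-- Whiten the first matrix, diagonalise the second one orthogonally and sort its eigenvalues. -/
lemma exists_isUnmixing (h₀ : M₀.PosDef) (hM : Mᵀ = M) : ∃ Gam L, IsUnmixing M₀ M Gam L := by
  obtain ⟨U, -, -, hU⟩ := exists_orthogonal_diagonal h₀.isHermitian
  set C : Matrix (Fin p) (Fin p) ℝ := diagonal (fun i => (√(h₀.isHermitian.eigenvalues i))⁻¹) * U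
    with hC
  have hC1 : C * M₀ * Cᵀ = 1 := by
    rw [hC, transpose_mul, diagonal_transpose]
    calc _ = diagonal (fun i => (√(h₀.isHermitian.eigenvalues i))⁻¹) * (U * M₀ * Uᵀ) *
        diagonal (fun i => (√(h₀.isHermitian.eigenvalues i))⁻¹) := by
          simp only [Matrix.mul_assoc]
      _ = 1 := by
          rw [hU, diagonal_mul_diagonal, diagonal_mul_diagonal, ← diagonal_one]
          congr 1
          ext i
          have h1 := h₀.eigenvalues_pos i
          have h2 := Real.mul_self_sqrt h1.le
          have h3 := (Real.sqrt_pos.2 h1).ne'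
          field_simp
          nlinarith
  have hN : (C * M * Cᵀ).IsHermitian := by
    rw [IsHermitian, conjTranspose_eq_transpose_of_trivial]
    simp [transpose_mul, hM, Matrix.mul_assoc]
  obtain ⟨V, hV1, -, hV⟩ := exists_orthogonal_diagonal hN
  set e := hN.eigenvalues
  let σ := Tuple.sort fun i => -e i
  have hσ : Antitone (e ∘ σ) := by
    intro i j hij
    have := Tuple.monotone_sort (fun i => -e i) hij
    simpa using this
  refine ⟨(V * C).submatrix σ id, (diagonal e).submatrix σ σ, ?_, ?_, ?_, ?_⟩
  · have h1 : (V * C) * M₀ * (V * C)ᵀ = 1 := by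
      rw [transpose_mul]
      calc _ = V * (C * M₀ * Cᵀ) * Vᵀ := by simp only [Matrix.mul_assoc]
        _ = 1 := by rw [hC1, Matrix.mul_one, hV1]
    have h2 : (V * C).submatrix σ id * M₀ * ((V * C).submatrix σ id)ᵀ =
        ((V * C) * M₀ * (V * C)ᵀ).submatrix σ σ := by
      ext i j; simp [Matrix.mul_apply]
    rw [h2, h1]; simp
  · have h1 : (V * C) * M * (V * C)ᵀ = diagonal e := by
      rw [transpose_mul, ← hV]
      simp only [Matrix.mul_assoc]
    have h2 : (V * C).submatrix σ id * M * ((V * C).submatrix σ id)ᵀ =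
        ((V * C) * M * (V * C)ᵀ).submatrix σ σ := by
      ext i j; simp [Matrix.mul_apply]
    rw [h2, h1]
  · intro i j hij
    simp [σ.injective.ne hij]
  · intro i j hij
    simpa using hσ hij

/-- Flipping the signs of rows of `Γ` gives another joint diagonalisation. -/
lemma IsUnmixing.exists_nonneg (h : IsUnmixing M₀ M Gam L) (B : Matrix (Fin p) (Fin p) ℝ) :
    ∃ Gam', IsUnmixing M₀ M Gam' L ∧ ∀ i, 0 ≤ (Gam' * B) i i := by
  let e : Fin p → ℝ := fun i => if 0 ≤ (Gam * B) i i then 1 else -1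
  have he : ∀ i, e i * e i = 1 := by intro i; simp only [e]; split_ifs <;> norm_num
  refine ⟨diagonal e * Gam, ⟨?_, ?_, h.isDiag, h.decreasing⟩, fun i => ?_⟩
  · rw [transpose_mul, diagonal_transpose]
    calc _ = diagonal e * (Gam * M₀ * Gamᵀ) * diagonal e := by simp only [Matrix.mul_assoc]
      _ = 1 := by
        rw [h.whiten, Matrix.mul_one, diagonal_mul_diagonal, ← diagonal_one]
        simp only [he]
  · rw [transpose_mul, diagonal_transpose]
    calc _ = diagonal e * (Gam * M * Gamᵀ) * diagonal e := by simp only [Matrix.mul_assoc]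
      _ = L := by
        rw [h.diagonalise, h.eq_diagonal, diagonal_mul_diagonal, diagonal_mul_diagonal]
        congr 1
        ext i
        calc e i * L i i * e i = (e i * e i) * L i i := by ring
          _ = L i i := by rw [he, one_mul]
  · rw [Matrix.mul_assoc, diagonal_mul]
    simp only [e]
    split_ifs with hi
    · simpa using hi
    · push Not at hi; linarith

/-- Joint diagonalisation is equivariant under changes of the mixing matrix, which reduces all
statements to the latent field. -/
lemma IsUnmixing.congr_basis (h : IsUnmixing M₀ M Gam L) {B W : Matrix (Fin p) (Fin p) ℝ}
    (hBW : B * W = 1) : IsUnmixing (W * M₀ * Wᵀ) (W * M * Wᵀ) (Gam * B) L := by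
  have key : ∀ N : Matrix (Fin p) (Fin p) ℝ,
      Gam * B * (W * N * Wᵀ) * (Gam * B)ᵀ = Gam * N * Gamᵀ := by
    intro N
    rw [transpose_mul]
    calc _ = Gam * (B * W) * N * (Wᵀ * Bᵀ) * Gamᵀ := by simp only [Matrix.mul_assoc]
      _ = _ := by rw [← transpose_mul, hBW]; simp
  exact ⟨by rw [key, h.whiten], by rw [key, h.diagonalise], h.isDiag, h.decreasing⟩

/-- The derivative at `(1, diag λ)`, in the direction `(T₀, T₁)`, of the joint diagonaliser `Γ`
whose diagonal is nonnegative. -/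
noncomputable def gamDeriv (lam : Fin p → ℝ) (T₀ T₁ : Matrix (Fin p) (Fin p) ℝ) :
    Matrix (Fin p) (Fin p) ℝ :=
  Matrix.of fun i j =>
    if i = j then -(1 / 2) * T₀ i j else (lam i * T₀ i j - T₁ i j) * (lam j - lam i)⁻¹

variable {ι : Type*} {l : Filter ι} {lam : ι → Fin p → ℝ} {lam' : Fin p → ℝ}
  {T₀ T₁ G Lh : ι → Matrix (Fin p) (Fin p) ℝ} {T₀' T₁' : Matrix (Fin p) (Fin p) ℝ} {r : ι → ℝ}

/-- Consistency: joint diagonalisations of matrices tending to `1` and `diag λ` converge.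
Along an ultrafilter `Γ` has a limit, since `ΓᵀΓ` is the inverse of the first matrix; this limit
jointly diagonalises the limiting pair, hence is the identity. -/
lemma tendsto_one_of_isUnmixing {N₀ N₁ : ι → Matrix (Fin p) (Fin p) ℝ} (hlam' : StrictAnti lam')
    (h₀ : Tendsto N₀ l (𝓝 1)) (h₁ : Tendsto N₁ l (𝓝 (diagonal lam')))
    (hG : ∀ᶠ x in l, IsUnmixing (N₀ x) (N₁ x) (G x) (Lh x)) (hG0 : ∀ᶠ x in l, ∀ i, 0 ≤ G x i i) :
    Tendsto G l (𝓝 1) ∧ Tendsto Lh l (𝓝 (diagonal lam')) := by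
  have hGt : Tendsto G l (𝓝 1) := by
    rw [tendsto_iff_ultrafilter]
    intro u hu
    have h₀u := h₀.mono_left hu
    have h₁u := h₁.mono_left hu
    have hGu := hG.filter_mono hu
    have hG0u := hG0.filter_mono hu
    have hinv : Tendsto (fun x => (N₀ x)⁻¹) u (𝓝 1) := by
      have hc : Tendsto (fun N : Matrix (Fin p) (Fin p) ℝ => N⁻¹) (𝓝 1) (𝓝 1) := by
        have : Tendsto (fun N : Matrix (Fin p) (Fin p) ℝ => (N.det)⁻¹ • N.adjugate) (𝓝 1)
            (𝓝 (((1 : Matrix (Fin p) (Fin p) ℝ).det)⁻¹ •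
              (1 : Matrix (Fin p) (Fin p) ℝ).adjugate)) := by
          refine Tendsto.smul (Tendsto.inv₀ ?_ (by simp)) ?_
          · exact (continuous_id.matrix_det).tendsto 1
          · exact (continuous_id.matrix_adjugate).tendsto 1
        simpa [Matrix.inv_def, Ring.inverse_eq_inv'] using this
      exact hc.comp h₀u
    have hdiag : ∀ j, ∀ᶠ x in (u : Filter ι), (N₀ x)⁻¹ j j < 4 := by
      intro j
      have h1 : Tendsto (fun x => (N₀ x)⁻¹ j j) u (𝓝 ((1 : Matrix (Fin p) (Fin p) ℝ) j j)) :=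
        tendsto_pi_nhds.1 (tendsto_pi_nhds.1 hinv j) j
      exact h1.eventually_lt_const (by simp)
    have hbd : ∀ i j, ∀ᶠ x in (u : Filter ι), G x i j ∈ Set.Icc (-2 : ℝ) 2 := by
      intro i j
      filter_upwards [hdiag j, hGu] with x hx hx'
      have h1 : (N₀ x)⁻¹ = (G x)ᵀ * G x := inv_eq_left_inv hx'.transpose_mul_mul
      have h2 : (G x i j) ^ 2 ≤ ((G x)ᵀ * G x) j j := by
        rw [Matrix.mul_apply]
        simp only [transpose_apply, ← sq]
        exact Finset.single_le_sum (f := fun i => G x i j ^ 2) (fun i _ => sq_nonneg _)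
          (Finset.mem_univ i)
      rw [h1] at hx
      exact abs_le.1 (abs_le_of_sq_le_sq (by linarith) (by norm_num))
    have hlim : ∀ i j, ∃ g : ℝ, Tendsto (fun x => G x i j) u (𝓝 g) := by
      intro i j
      obtain ⟨g, -, hg⟩ := isCompact_Icc.ultrafilter_le_nhds (u.map fun x => G x i j)
        (le_principal_iff.2 (hbd i j))
      exact ⟨g, hg⟩
    choose G' hG' using hlim
    have hG' : Tendsto G u (𝓝 (Matrix.of G')) :=
      tendsto_pi_nhds.2 fun i => tendsto_pi_nhds.2 fun j => hG' i j
    have hprod : ∀ {N : ι → Matrix (Fin p) (Fin p) ℝ} {N'}, Tendsto N u (𝓝 N') →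
        Tendsto (fun x => G x * N x * (G x)ᵀ) u (𝓝 (Matrix.of G' * N' * (Matrix.of G')ᵀ)) :=
      fun hN => (hG'.mul hN).mul ((continuous_id.matrix_transpose.tendsto _).comp hG')
    have hL : Tendsto Lh u (𝓝 (Matrix.of G' * diagonal lam' * (Matrix.of G')ᵀ)) :=
      (hprod h₁u).congr' (hGu.mono fun x hx => hx.diagonalise)
    have hLe : ∀ i j, Tendsto (fun x => Lh x i j) u
        (𝓝 ((Matrix.of G' * diagonal lam' * (Matrix.of G')ᵀ) i j)) :=
      fun i j => tendsto_pi_nhds.1 (tendsto_pi_nhds.1 hL i) j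
    have hw : IsUnmixing 1 (diagonal lam') (Matrix.of G')
        (Matrix.of G' * diagonal lam' * (Matrix.of G')ᵀ) := by
      refine ⟨?_, rfl, ?_, ?_⟩
      · exact tendsto_nhds_unique ((hprod h₀u).congr' (hGu.mono fun x hx => hx.whiten))
          tendsto_const_nhds
      · intro i j hij
        exact tendsto_nhds_unique ((hLe i j).congr' (hGu.mono fun x hx => hx.isDiag hij))
          tendsto_const_nhds
      · intro i j hij
        exact le_of_tendsto_of_tendsto (hLe j j) (hLe i i)
          (hGu.mono fun x hx => hx.decreasing i j hij)
    have h1 : Matrix.of G' = 1 := by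
      refine hw.eq_one_of_one hlam' fun i => ?_
      exact ge_of_tendsto (tendsto_pi_nhds.1 (tendsto_pi_nhds.1 hG' i) i)
        (hG0u.mono fun x hx => hx i)
    rwa [h1] at hG'
  refine ⟨hGt, ?_⟩
  have := (hGt.mul h₁).mul ((continuous_id.matrix_transpose.tendsto _).comp hGt)
  simp only [Matrix.one_mul, id, transpose_one, Matrix.mul_one, Function.comp_def] at this
  exact this.congr' (hG.mono fun x hx => hx.diagonalise)

/-- First-order expansion of the joint diagonalisation. The relation `Γ M = Λ Γ M₀` expresses the
off-diagonal entries of `Γ` and the increments of `Λ` exactly through `r`, `Γ` and `Λ`;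
the normalisation `Γ M₀ Γᵀ = 1` then gives the diagonal of `Γ`. -/
lemma tendsto_deriv_of_isUnmixing (hlam' : StrictAnti lam') (hlam : Tendsto lam l (𝓝 lam'))
    (hr : Tendsto r l (𝓝 0)) (hr0 : ∀ᶠ x in l, r x ≠ 0)
    (h₀ : Tendsto T₀ l (𝓝 T₀')) (h₁ : Tendsto T₁ l (𝓝 T₁'))
    (hG : ∀ᶠ x in l, IsUnmixing (1 + r x • T₀ x) (diagonal (lam x) + r x • T₁ x) (G x) (Lh x))
    (hG0 : ∀ᶠ x in l, ∀ i, 0 ≤ G x i i) :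
    Tendsto (fun x => (r x)⁻¹ • (G x - 1)) l (𝓝 (gamDeriv lam' T₀' T₁')) ∧
    ∀ i, Tendsto (fun x => (r x)⁻¹ * (Lh x i i - lam x i)) l (𝓝 (T₁' i i - lam' i * T₀' i i)) := by
  have hN₀ : Tendsto (fun x => 1 + r x • T₀ x) l (𝓝 1) := by
    simpa using (tendsto_const_nhds (x := (1 : Matrix (Fin p) (Fin p) ℝ))).add (hr.smul h₀)
  have hN₁ : Tendsto (fun x => diagonal (lam x) + r x • T₁ x) l (𝓝 (diagonal lam')) := by
    simpa using ((continuous_id.matrix_diagonal.tendsto lam').comp hlam).add (hr.smul h₁)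
  obtain ⟨hG1, hL1⟩ := tendsto_one_of_isUnmixing hlam' hN₀ hN₁ hG hG0
  have ent : ∀ {N : ι → Matrix (Fin p) (Fin p) ℝ} {N'}, Tendsto N l (𝓝 N') → ∀ i j,
      Tendsto (fun x => N x i j) l (𝓝 (N' i j)) :=
    fun hN i j => tendsto_pi_nhds.1 (tendsto_pi_nhds.1 hN i) j
  have hGT₀ : ∀ i j, Tendsto (fun x => (G x * T₀ x) i j) l (𝓝 (T₀' i j)) := by
    simpa using ent (hG1.mul h₀)
  have hGT₁ : ∀ i j, Tendsto (fun x => (G x * T₁ x) i j) l (𝓝 (T₁' i j)) := by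
    simpa using ent (hG1.mul h₁)
  have hlamc : ∀ i, Tendsto (fun x => lam x i) l (𝓝 (lam' i)) := tendsto_pi_nhds.1 hlam
  have hLc : ∀ i, Tendsto (fun x => Lh x i i) l (𝓝 (lam' i)) := fun i => by
    simpa using ent hL1 i i
  have hGc : ∀ i j, Tendsto (fun x => G x i j) l (𝓝 ((1 : Matrix (Fin p) (Fin p) ℝ) i j)) :=
    ent hG1
  have key : ∀ᶠ x in l, ∀ i j, G x i j * (lam x j - Lh x i i) =
      r x * (Lh x i i * (G x * T₀ x) i j - (G x * T₁ x) i j) := by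
    filter_upwards [hG] with x hx i j
    have h1 := congrFun (congrFun hx.mul_eq i) j
    rw [hx.eq_diagonal, Matrix.mul_assoc, Matrix.mul_add, Matrix.mul_add, diagonal_mul] at h1
    simp only [Matrix.mul_one, Matrix.mul_smul, Matrix.add_apply, Matrix.smul_apply, smul_eq_mul,
      mul_diagonal] at h1
    linarith
  have hoff : ∀ i j, i ≠ j → Tendsto (fun x => (r x)⁻¹ * G x i j) l
      (𝓝 ((lam' i * T₀' i j - T₁' i j) * (lam' j - lam' i)⁻¹)) := by
    intro i j hij
    have hne : lam' j - lam' i ≠ 0 := sub_ne_zero.2 (hlam'.injective.ne hij.symm)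
    have hd : Tendsto (fun x => lam x j - Lh x i i) l (𝓝 (lam' j - lam' i)) :=
      (hlamc j).sub (hLc i)
    have h2 := (((hLc i).mul (hGT₀ i j)).sub (hGT₁ i j)).mul (hd.inv₀ hne)
    refine h2.congr' ?_
    filter_upwards [key, hr0, hd.eventually_ne hne] with x hx hrx hdx
    have := hx i j
    field_simp
    linarith
  refine ⟨?_, fun i => ?_⟩
  · refine tendsto_pi_nhds.2 fun i => tendsto_pi_nhds.2 fun j => ?_
    by_cases hij : i = j
    · subst hij
      have h3 : Tendsto (fun x => ∑ j ∈ Finset.univ.erase i, (r x)⁻¹ * G x i j * G x i j) l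
          (𝓝 0) := by
        rw [← Finset.sum_const_zero (s := Finset.univ.erase i)]
        refine tendsto_finsetSum _ fun j hj => ?_
        have hij := (Finset.ne_of_mem_erase hj).symm
        have := (hoff i j hij).mul (hGc i j)
        rwa [one_apply_ne hij, mul_zero] at this
      have h4 : Tendsto (fun x => (G x * T₀ x * (G x)ᵀ) i i) l (𝓝 (T₀' i i)) := by
        have := (hG1.mul h₀).mul ((continuous_id.matrix_transpose.tendsto _).comp hG1)
        simpa using ent this i i
      have h5 : Tendsto (fun x => G x i i + 1) l (𝓝 2) := by
        have := (hGc i i).add_const 1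
        rwa [one_apply_eq, one_add_one_eq_two] at this
      have h6 := ((h4.add h3).neg).mul (h5.inv₀ two_ne_zero)
      have h7 : -(T₀' i i + 0) * (2 : ℝ)⁻¹ = gamDeriv lam' T₀' T₁' i i := by
        simp [gamDeriv]; ring
      rw [h7] at h6
      refine h6.congr' ?_
      filter_upwards [hG, hr0, h5.eventually_ne two_ne_zero] with x hx hrx h5x
      have h8 := congrFun (congrFun hx.whiten i) i
      rw [Matrix.mul_add, Matrix.add_mul, Matrix.add_apply, Matrix.mul_one, one_apply_eq,
        Matrix.mul_smul, Matrix.smul_mul, Matrix.smul_apply, smul_eq_mul, Matrix.mul_apply,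
        ← Finset.add_sum_erase _ _ (Finset.mem_univ i)] at h8
      simp only [transpose_apply] at h8
      have h9 : ∑ j ∈ Finset.univ.erase i, (r x)⁻¹ * G x i j * G x i j =
          (r x)⁻¹ * ∑ j ∈ Finset.univ.erase i, G x i j * G x i j := by
        rw [Finset.mul_sum]; simp only [mul_assoc]
      simp only [Matrix.smul_apply, Matrix.sub_apply, one_apply_eq, smul_eq_mul]
      rw [h9]
      set A := ∑ j ∈ Finset.univ.erase i, G x i j * G x i j
      field_simp
      linarith
    · have h1 := hoff i j hij
      simp only [gamDeriv, Matrix.of_apply, if_neg hij]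
      refine h1.congr fun x => ?_
      simp [one_apply_ne hij]
  · have h1 : Tendsto (fun x => G x i i) l (𝓝 1) := by simpa using hGc i i
    have h2 := ((hGT₁ i i).sub ((hLc i).mul (hGT₀ i i))).mul (h1.inv₀ one_ne_zero)
    rw [inv_one, mul_one] at h2
    refine h2.congr' ?_
    filter_upwards [key, hr0, h1.eventually_ne one_ne_zero] with x hx hrx hgx
    have := hx i i
    field_simp
    linarith

end Unmixing

/-! ### Sums of a decaying function over separated points -/

section Packing

lemma inv_one_add_rpow_le {t r : ℝ} (ht : 0 ≤ t) (hr : 0 ≤ r) :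
    (1 + t ^ r)⁻¹ ≤ 2 ^ r * (1 + t) ^ (-r) := by
  have h0 : 0 ≤ t ^ r := Real.rpow_nonneg ht r
  have h1 : (1 + t) ^ r ≤ 2 ^ r * (1 + t ^ r) := by
    have h2 : (0 : ℝ) ≤ 2 ^ r := by positivity
    rcases le_total t 1 with h | h
    · have : (1 + t) ^ r ≤ 2 ^ r := Real.rpow_le_rpow (by linarith) (by linarith) hr
      nlinarith
    · have : (1 + t) ^ r ≤ (2 * t) ^ r := Real.rpow_le_rpow (by linarith) (by linarith) hr
      rw [Real.mul_rpow (by norm_num) ht] at this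
      nlinarith
  have h3 : 0 < (1 + t) ^ r := Real.rpow_pos_of_pos (by linarith) r
  rw [Real.rpow_neg (by linarith), ← div_eq_mul_inv, inv_eq_one_div,
    div_le_div_iff₀ (by linarith) h3]
  linarith

/-- The sums of `1 / (1 + ‖x - y‖ ^ r)`, with `r > d`, over the points `y` of a `Δ`-separated set
are bounded: they are compared with the integral over the disjoint balls around the points. -/
lemma exists_sum_inv_one_add_norm_rpow_le (d : ℕ) {Δ α : ℝ} (hΔ : 0 < Δ) (hα : 0 < α) :
    ∃ C : ℝ, ∀ (n : ℕ) (s : Fin n → Loc d), (∀ i j, i ≠ j → Δ ≤ ‖s i - s j‖) →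
      ∀ i, ∑ j, (1 + ‖s i - s j‖ ^ ((d : ℝ) + α))⁻¹ ≤ C := by
  set r : ℝ := d + α with hr
  have hr0 : 0 ≤ r := by positivity
  set g : Loc d → ℝ := fun x => (1 + ‖x‖) ^ (-r) with hg
  have hgi : Integrable g := integrable_one_add_norm (by simp [hr, hα])
  have hg0 : ∀ x, 0 ≤ g x := fun x => by positivity
  set v : ℝ := volume.real (Metric.ball (0 : Loc d) (Δ / 2)) with hv
  have hvpos : 0 < v := by
    refine ENNReal.toReal_pos ?_ measure_ball_lt_top.ne
    exact (Metric.measure_ball_pos _ _ (by linarith)).ne'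
  set c : ℝ := (1 + Δ / 2) ^ r with hc
  have hcpos : 0 < c := Real.rpow_pos_of_pos (by linarith) r
  have key : ∀ y : Loc d, g y * v ≤ c * ∫ x in Metric.ball y (Δ / 2), g x := by
    intro y
    have h1 : volume.real (Metric.ball y (Δ / 2)) = v := by
      rw [hv, measureReal_def, measureReal_def, Measure.addHaar_ball_center]
    have h2 : ∀ x ∈ Metric.ball y (Δ / 2), c⁻¹ * g y ≤ g x := by
      intro x hx
      have h3 : ‖x‖ ≤ ‖y‖ + Δ / 2 := by
        have := norm_sub_norm_le x y
        rw [mem_ball_iff_norm] at hx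
        linarith
      have h4 : c⁻¹ * g y = ((1 + Δ / 2) * (1 + ‖y‖)) ^ (-r) := by
        rw [Real.mul_rpow (by linarith) (by positivity), hc, ← Real.rpow_neg (by linarith)]
      rw [h4]
      refine Real.rpow_le_rpow_of_nonpos (by positivity) ?_ (by linarith)
      nlinarith [norm_nonneg y]
    have h5 : ∫ _x in Metric.ball y (Δ / 2), c⁻¹ * g y ≤ ∫ x in Metric.ball y (Δ / 2), g x :=
      setIntegral_mono_on (integrableOn_const measure_ball_lt_top.ne) hgi.integrableOn
        Metric.isOpen_ball.measurableSet h2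
    rw [setIntegral_const, h1, smul_eq_mul] at h5
    calc g y * v = c * (v * (c⁻¹ * g y)) := by field_simp
      _ ≤ _ := by gcongr
  refine ⟨2 ^ r * (c * (∫ x, g x) / v), fun n s hs i => ?_⟩
  have hdisj : Pairwise (Function.onFun Disjoint fun j => Metric.ball (s i - s j) (Δ / 2)) := by
    intro j k hjk
    refine Metric.ball_disjoint_ball ?_
    rw [dist_eq_norm, sub_sub_sub_cancel_left, norm_sub_rev]
    linarith [hs j k hjk]
  have h1 : ∑ j, ∫ x in Metric.ball (s i - s j) (Δ / 2), g x ≤ ∫ x, g x := by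
    rw [← integral_iUnion_fintype (fun j => Metric.isOpen_ball.measurableSet) hdisj
      (fun j => hgi.integrableOn)]
    exact setIntegral_le_integral hgi (ae_of_all _ hg0)
  calc ∑ j, (1 + ‖s i - s j‖ ^ r)⁻¹ ≤ ∑ j, 2 ^ r * g (s i - s j) :=
        Finset.sum_le_sum fun j _ => inv_one_add_rpow_le (norm_nonneg _) hr0
    _ = 2 ^ r * ((∑ j, g (s i - s j) * v) / v) := by
        rw [← Finset.sum_mul, mul_div_assoc, div_self hvpos.ne', mul_one, Finset.mul_sum]
    _ ≤ 2 ^ r * (c * (∫ x, g x) / v) := by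
        gcongr
        calc _ ≤ ∑ j, c * ∫ x in Metric.ball (s i - s j) (Δ / 2), g x :=
              Finset.sum_le_sum fun j _ => key _
          _ ≤ _ := by rw [← Finset.mul_sum]; gcongr

end Packing

/-! ### Quadratic forms in Gaussian vectors -/

section QuadraticForm

open Matrix

lemma hasDerivAt_mul_exp_sq {g : ℝ → ℝ} {g' t : ℝ} (hg : HasDerivAt g g' t) :
    HasDerivAt (fun t => g t * Real.exp (t ^ 2 / 2)) ((g' + t * g t) * Real.exp (t ^ 2 / 2)) t := by
  have h1 : HasDerivAt (fun t : ℝ => t ^ 2 / 2) t t := by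
    simpa using (hasDerivAt_pow 2 t).div_const 2
  exact (hg.mul h1.exp).congr_deriv (by ring)

lemma integral_pow_four_gaussianReal : ∫ x, x ^ 4 ∂gaussianReal 0 1 = 3 := by
  have h1 := iteratedDeriv_mgf_zero (X := (id : ℝ → ℝ)) (μ := gaussianReal 0 1)
    (by simp [integrableExpSet_id_gaussianReal]) 4
  have h2 : mgf id (gaussianReal 0 1) = fun t => 1 * Real.exp (t ^ 2 / 2) := by
    rw [mgf_id_gaussianReal]; simp
  have d1 : deriv (fun t : ℝ => 1 * Real.exp (t ^ 2 / 2)) = fun t => t * Real.exp (t ^ 2 / 2) := by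
    ext t
    rw [(hasDerivAt_mul_exp_sq (hasDerivAt_const t (1 : ℝ))).deriv]; ring
  have d2 : deriv (fun t : ℝ => t * Real.exp (t ^ 2 / 2)) =
      fun t => (1 + t ^ 2) * Real.exp (t ^ 2 / 2) := by
    ext t
    rw [(hasDerivAt_mul_exp_sq (hasDerivAt_id' t)).deriv]; ring
  have d3 : deriv (fun t : ℝ => (1 + t ^ 2) * Real.exp (t ^ 2 / 2)) =
      fun t => (3 * t + t ^ 3) * Real.exp (t ^ 2 / 2) := by
    ext t
    rw [(hasDerivAt_mul_exp_sq ((hasDerivAt_pow 2 t).const_add 1)).deriv]; norm_num; ring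
  have d4 : deriv (fun t : ℝ => (3 * t + t ^ 3) * Real.exp (t ^ 2 / 2)) 0 = 3 := by
    have h3 : HasDerivAt (fun t : ℝ => 3 * t + t ^ 3) 3 0 := by
      exact (((hasDerivAt_id' (0 : ℝ)).const_mul 3).add (hasDerivAt_pow 3 (0 : ℝ))).congr_deriv
        (by norm_num)
    rw [(hasDerivAt_mul_exp_sq h3).deriv]; simp
  rw [h2, iteratedDeriv_succ', iteratedDeriv_succ', iteratedDeriv_succ', iteratedDeriv_succ', d1,
    d2, d3, iteratedDeriv_zero, d4] at h1
  simpa using h1.symm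

lemma integrable_pow_gaussianReal (k : ℕ) : Integrable (fun x : ℝ => x ^ k) (gaussianReal 0 1) := by
  have h := (memLp_id_gaussianReal (μ := 0) (v := 1) (k : NNReal))
  rcases Nat.eq_zero_or_pos k with rfl | hk
  · simp
  have h' : MemLp id (k : ENNReal) (gaussianReal 0 1) := by simpa using h
  have h2 := h'.integrable_norm_pow hk.ne'
  refine (integrable_norm_iff (by fun_prop)).1 ?_
  simpa [norm_pow] using h2

lemma integral_sq_gaussianReal : ∫ x, x ^ 2 ∂gaussianReal 0 1 = 1 := by
  have h1 := variance_of_integral_eq_zero (μ := gaussianReal 0 1) (X := fun x => x)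
    (by fun_prop) (by simp)
  rw [variance_fun_id_gaussianReal] at h1
  simpa using h1.symm

/-- The characteristic function of `x² - 1` for a standard normal `x`. -/
noncomputable def chiChar (c : ℝ) : ℂ :=
  ∫ x, Complex.exp ((c * (x ^ 2 - 1) : ℝ) * Complex.I) ∂gaussianReal 0 1

lemma norm_chiChar_le (c : ℝ) : ‖chiChar c‖ ≤ 1 := by
  refine (norm_integral_le_integral_norm _).trans ?_
  simp only [Complex.norm_exp_ofReal_mul_I]
  simp

/-- Second-order Taylor expansion of the characteristic function of `x² - 1`, a variable with mean
zero and variance two. -/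
lemma chiChar_sub_exp_le {ε : ℝ} (hε : 0 < ε) : ∃ δ > 0, ∀ c : ℝ, |c| ≤ δ →
    ‖chiChar c - Complex.exp (-(c ^ 2 : ℝ))‖ ≤ ε * c ^ 2 := by
  let X : ℝ → ℝ := fun x => (x ^ 2 - 1) / √2
  have hs : √2 * √2 = (2 : ℝ) := Real.mul_self_sqrt (by norm_num)
  have hs0 : (0 : ℝ) < √2 := by positivity
  have i2 := integrable_pow_gaussianReal 2
  have i4 := integrable_pow_gaussianReal 4
  have hX0 : ∫ x, X x ∂gaussianReal 0 1 = 0 := by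
    simp only [X]
    rw [integral_div, integral_sub i2 (integrable_const _), integral_sq_gaussianReal]
    simp
  have hX1 : ∫ x, (X ^ 2) x ∂gaussianReal 0 1 = 1 := by
    have h1 : ∀ x, (X ^ 2) x = (x ^ 4 - 2 * x ^ 2 + 1) / 2 := by
      intro x
      simp only [X, Pi.pow_apply, div_pow, Real.sq_sqrt (show (0 : ℝ) ≤ 2 by norm_num)]
      ring
    simp only [h1]
    rw [integral_div, integral_add (by exact i4.sub (i2.const_mul 2)) (integrable_const _),
      integral_sub i4 (i2.const_mul 2), integral_const_mul, integral_sq_gaussianReal,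
      integral_pow_four_gaussianReal]
    norm_num
  have hXm : AEMeasurable X (gaussianReal 0 1) := by fun_prop
  have h2 := (taylor_charFun_two hXm hX0 hX1).def (show 0 < ε / 4 by positivity)
  obtain ⟨δ, hδ, h3⟩ := Metric.eventually_nhds_iff.1 h2
  have hcf : ∀ c : ℝ, charFun ((gaussianReal 0 1).map X) (√2 * c) = chiChar c := by
    intro c
    rw [charFun_apply_real, integral_map hXm (by fun_prop), chiChar]
    congr 1
    ext x
    congr 2
    rw [← Complex.ofReal_mul]
    congr 1
    simp only [X]
    field_simp
  refine ⟨min (δ / 2) (min 1 (√(ε / 2))), by positivity, fun c hc => ?_⟩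
  have hc1 : |c| ≤ δ / 2 := hc.trans (min_le_left _ _)
  have hc2 : |c| ≤ 1 := hc.trans ((min_le_right _ _).trans (min_le_left _ _))
  have hc3 : |c| ≤ √(ε / 2) := hc.trans ((min_le_right _ _).trans (min_le_right _ _))
  have hc4 : c ^ 2 ≤ ε / 2 := by
    rw [← sq_abs, ← Real.sq_sqrt (show 0 ≤ ε / 2 by positivity)]
    exact pow_le_pow_left₀ (abs_nonneg _) hc3 2
  have h4 := h3 (y := √2 * c) (by
    rw [Real.dist_eq, sub_zero, abs_mul, abs_of_pos hs0]
    have : √2 < 2 := by nlinarith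
    nlinarith [abs_nonneg c])
  rw [hcf] at h4
  have h5 : (1 : ℂ) - ((√2 * c : ℝ) : ℂ) ^ 2 / 2 = ((1 - c ^ 2 : ℝ) : ℂ) := by
    rw [← Complex.ofReal_pow, mul_pow, Real.sq_sqrt (by norm_num)]
    push_cast; ring
  rw [h5, Real.norm_eq_abs, abs_of_nonneg (sq_nonneg (√2 * c)), mul_pow,
    Real.sq_sqrt (by norm_num)] at h4
  have h6 : |Real.exp (-c ^ 2) - 1 - -c ^ 2| ≤ (-c ^ 2) ^ 2 := by
    refine Real.abs_exp_sub_one_sub_id_le ?_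
    rw [abs_neg, abs_pow]
    exact pow_le_one₀ (abs_nonneg _) hc2
  have h7 : ‖((1 - c ^ 2 : ℝ) : ℂ) - Complex.exp (-(c ^ 2 : ℝ))‖ ≤ (c ^ 2) ^ 2 := by
    rw [← Complex.ofReal_neg, ← Complex.ofReal_exp, ← Complex.ofReal_sub, Complex.norm_real,
      Real.norm_eq_abs, abs_sub_comm]
    calc _ = |Real.exp (-c ^ 2) - 1 - -c ^ 2| := by congr 1; ring
      _ ≤ _ := h6.trans (by rw [neg_sq])
  calc _ = ‖(chiChar c - ((1 - c ^ 2 : ℝ) : ℂ)) +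
        (((1 - c ^ 2 : ℝ) : ℂ) - Complex.exp (-(c ^ 2 : ℝ)))‖ := by congr 1; ring
    _ ≤ ε / 4 * (2 * c ^ 2) + (c ^ 2) ^ 2 := (norm_add_le _ _).trans (add_le_add h4 h7)
    _ ≤ ε * c ^ 2 := by nlinarith [sq_nonneg c]

lemma norm_prod_sub_prod_le {ι : Type*} (t : Finset ι) {a b : ι → ℂ} (ha : ∀ i, ‖a i‖ ≤ 1)
    (hb : ∀ i, ‖b i‖ ≤ 1) : ‖∏ i ∈ t, a i - ∏ i ∈ t, b i‖ ≤ ∑ i ∈ t, ‖a i - b i‖ := by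
  classical
  induction t using Finset.induction_on with
  | empty => simp
  | insert i t hi ih =>
    rw [Finset.prod_insert hi, Finset.prod_insert hi, Finset.sum_insert hi]
    have h1 : ‖∏ j ∈ t, b j‖ ≤ 1 := by
      rw [norm_prod]
      exact Finset.prod_le_one (fun j _ => norm_nonneg _) fun j _ => hb j
    calc _ = ‖a i * (∏ j ∈ t, a j - ∏ j ∈ t, b j) + (a i - b i) * ∏ j ∈ t, b j‖ := by
          congr 1; ring
      _ ≤ ‖a i‖ * ‖∏ j ∈ t, a j - ∏ j ∈ t, b j‖ + ‖a i - b i‖ * ‖∏ j ∈ t, b j‖ :=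
          (norm_add_le _ _).trans (by rw [norm_mul, norm_mul])
      _ ≤ 1 * (∑ j ∈ t, ‖a j - b j‖) + ‖a i - b i‖ * 1 := by gcongr; exact ha i
      _ = _ := by ring

lemma prod_chiChar_sub_exp_le {ε : ℝ} (hε : 0 < ε) : ∃ δ > 0, ∀ {ι : Type} [Fintype ι] (c : ι → ℝ),
    (∀ i, |c i| ≤ δ) →
    ‖∏ i, chiChar (c i) - Complex.exp (-(∑ i, c i ^ 2 : ℝ))‖ ≤ ε * ∑ i, c i ^ 2 := by
  obtain ⟨δ, hδ, h⟩ := chiChar_sub_exp_le hε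
  refine ⟨δ, hδ, fun c hc => ?_⟩
  have h1 : Complex.exp (-(∑ i, c i ^ 2 : ℝ)) = ∏ i, Complex.exp (-(c i ^ 2 : ℝ)) := by
    rw [← Complex.exp_sum, Complex.ofReal_sum, Finset.sum_neg_distrib]
  rw [h1, Finset.mul_sum]
  refine (norm_prod_sub_prod_le _ (fun i => norm_chiChar_le _) fun i => ?_).trans
    (Finset.sum_le_sum fun i _ => h _ (hc i))
  rw [← Complex.ofReal_neg, ← Complex.ofReal_exp, Complex.norm_real, Real.norm_eq_abs,
    abs_of_pos (Real.exp_pos _), Real.exp_le_one_iff]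
  nlinarith [sq_nonneg (c i)]

section Norm

attribute [local instance] Matrix.linftyOpNormedRing Matrix.linftyOpNormedAlgebra

variable {ι : Type*} [Fintype ι] [DecidableEq ι]

lemma linfty_opNorm_le {A : Matrix ι ι ℝ} {C : ℝ} (hC : 0 ≤ C) (h : ∀ i, ∑ j, |A i j| ≤ C) :
    ‖A‖ ≤ C := by
  rw [Matrix.linfty_opNorm_def]
  lift C to NNReal using hC
  rw [NNReal.coe_le_coe]
  refine Finset.sup_le fun i _ => ?_
  rw [← NNReal.coe_le_coe]
  simpa using h i

lemma abs_apply_le_linfty_opNorm (A : Matrix ι ι ℝ) (i j : ι) : |A i j| ≤ ‖A‖ := by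
  rw [Matrix.linfty_opNorm_def]
  have h1 : ∑ j, ‖A i j‖₊ ≤ Finset.univ.sup fun i => ∑ j, ‖A i j‖₊ :=
    Finset.le_sup (f := fun i => ∑ j, ‖A i j‖₊) (Finset.mem_univ i)
  have h2 : ‖A i j‖₊ ≤ ∑ j, ‖A i j‖₊ :=
    Finset.single_le_sum (f := fun j => ‖A i j‖₊) (fun _ _ => zero_le) (Finset.mem_univ j)
  exact NNReal.coe_le_coe.2 (h2.trans h1)

lemma abs_trace_le (A : Matrix ι ι ℝ) : |A.trace| ≤ Fintype.card ι * ‖A‖ := by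
  rw [Matrix.trace]
  refine (Finset.abs_sum_le_sum_abs _ _).trans ?_
  refine (Finset.sum_le_card_nsmul _ _ ‖A‖ fun i _ => abs_apply_le_linfty_opNorm A i i).trans ?_
  simp

/-- `q S q` and `S q²` have the same nonzero eigenvalues, so they are bounded by the product of the
maximal row sums of `|S|` and `|q²|`; no row sums of the square root `q` enter. -/
lemma abs_eigenvalues_le {q S : Matrix ι ι ℝ} (hB : (q * S * q).IsHermitian) (i : ι) :
    |hB.eigenvalues i| ≤ ‖S‖ * ‖q * q‖ := by
  by_cases h0 : hB.eigenvalues i = 0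
  · rw [h0, abs_zero]; positivity
  have h1 : hB.eigenvalues i ∈ spectrum ℝ (q * (S * q)) \ {0} := by
    rw [← Matrix.mul_assoc]
    exact ⟨hB.eigenvalues_mem_spectrum_real i, h0⟩
  rw [spectrum.nonzero_mul_comm, Matrix.mul_assoc] at h1
  have : Nonempty ι := ⟨i⟩
  have h2 := spectrum.norm_le_norm_of_mem h1.1
  exact h2.trans (Matrix.linfty_opNorm_mul _ _)

end Norm

end QuadraticForm

section GaussianForm

open Matrix

variable {ι : Type*} [Fintype ι] [DecidableEq ι]

lemma trace_eq_sum_eigenvalues_real {B : Matrix ι ι ℝ} (hB : B.IsHermitian) :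
    B.trace = ∑ i, hB.eigenvalues i := by
  simpa using hB.trace_eq_sum_eigenvalues

lemma trace_mul_self_eq_sum_eigenvalues {B : Matrix ι ι ℝ} (hB : B.IsHermitian) :
    (B * B).trace = ∑ i, hB.eigenvalues i ^ 2 := by
  obtain ⟨U, hU1, hU2, hU⟩ := exists_orthogonal_diagonal hB
  have h1 : U * (B * B) * Uᵀ = diagonal fun i => hB.eigenvalues i ^ 2 := by
    calc U * (B * B) * Uᵀ = U * B * (Uᵀ * U) * B * Uᵀ := by
          rw [hU2, Matrix.mul_one]; simp only [Matrix.mul_assoc]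
      _ = (U * B * Uᵀ) * (U * B * Uᵀ) := by simp only [Matrix.mul_assoc]
      _ = _ := by rw [hU, diagonal_mul_diagonal]; simp only [sq]
  rw [← trace_diagonal, ← h1, Matrix.trace_mul_comm _ Uᵀ, ← Matrix.mul_assoc Uᵀ, hU2,
    Matrix.one_mul]

/-- In an orthonormal eigenbasis of `B`, the form `yᵀ B y` is a weighted sum of independent squares
of standard normal variables. -/
lemma integral_quadratic_stdGaussian {B : Matrix ι ι ℝ} (hB : B.IsHermitian) (t : ℝ) :
    ∫ y, Complex.exp ((t * (y.ofLp ⬝ᵥ B *ᵥ y.ofLp - B.trace) : ℝ) * Complex.I)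
      ∂stdGaussian (EuclideanSpace ℝ ι) = ∏ i, chiChar (t * hB.eigenvalues i) := by
  have hform : ∀ x : ι → ℝ, (∑ i, x i • hB.eigenvectorBasis i).ofLp ⬝ᵥ
      B *ᵥ (∑ i, x i • hB.eigenvectorBasis i).ofLp = ∑ i, hB.eigenvalues i * x i ^ 2 := by
    intro x
    have h1 : toEuclideanCLM (𝕜 := ℝ) B (∑ i, x i • hB.eigenvectorBasis i) =
        ∑ i, (hB.eigenvalues i * x i) • hB.eigenvectorBasis i := by
      rw [map_sum]
      refine Finset.sum_congr rfl fun i _ => ?_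
      rw [map_smul]
      have h2 : toEuclideanCLM (𝕜 := ℝ) B (hB.eigenvectorBasis i) =
          hB.eigenvalues i • hB.eigenvectorBasis i := by
        ext j
        have := congrFun (hB.mulVec_eigenvectorBasis i) j
        simpa using this
      rw [h2, smul_smul, mul_comm]
    rw [← inner_toEuclideanCLM, h1, hB.eigenvectorBasis.orthonormal.inner_sum]
    refine Finset.sum_congr rfl fun i _ => ?_
    simp only [conj_trivial]
    ring
  rw [stdGaussian_eq_map_pi_orthonormalBasis hB.eigenvectorBasis, integral_map]
  · simp only [hform]
    have h3 : ∀ x : ι → ℝ, Complex.exp ((t * (∑ i, hB.eigenvalues i * x i ^ 2 - B.trace) : ℝ) *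
        Complex.I) =
        ∏ i, Complex.exp ((t * hB.eigenvalues i * (x i ^ 2 - 1) : ℝ) * Complex.I) := by
      intro x
      rw [← Complex.exp_sum, ← Finset.sum_mul, ← Complex.ofReal_sum,
        trace_eq_sum_eigenvalues_real hB, ← Finset.sum_sub_distrib, Finset.mul_sum]
      refine congrArg (fun u : ℝ => Complex.exp (u * Complex.I))
        (Finset.sum_congr rfl fun i _ => ?_)
      ring
    simp only [h3]
    exact integral_fintype_prod_eq_prod
      (fun i (x : ℝ) => Complex.exp ((t * hB.eigenvalues i * (x ^ 2 - 1) : ℝ) * Complex.I))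
  · exact Measurable.aemeasurable (by fun_prop)
  · refine Continuous.aestronglyMeasurable ?_
    simp only [dotProduct, mulVec]
    fun_prop

/-- The characteristic function of a centred quadratic form in a Gaussian vector with covariance
matrix `R = q²`; the weights are the eigenvalues of `q S q`. -/
lemma exists_integral_quadratic_multivariateGaussian {R S : Matrix ι ι ℝ} (hR : R.PosSemidef)
    (hS : S.IsHermitian) : ∃ (q : Matrix ι ι ℝ) (hB : (q * S * q).IsHermitian), q * q = R ∧
      ∀ t : ℝ, ∫ z, Complex.exp ((t * (z.ofLp ⬝ᵥ S *ᵥ z.ofLp - (R * S).trace) : ℝ) * Complex.I)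
        ∂multivariateGaussian 0 R = ∏ i, chiChar (t * hB.eigenvalues i) := by
  open scoped MatrixOrder in
  set q := CFC.sqrt R with hq
  have hqq : q * q = R := CFC.sqrt_mul_sqrt_self _ hR.nonneg
  have hqh : qᴴ = q := (CFC.sqrt_nonneg R).isSelfAdjoint
  have hqt : qᵀ = q := by rwa [conjTranspose_eq_transpose_of_trivial] at hqh
  have hB : (q * S * q).IsHermitian := by
    rw [IsHermitian, conjTranspose_mul, conjTranspose_mul, hS.eq, hqh, Matrix.mul_assoc]
  refine ⟨q, hB, hqq, fun t => ?_⟩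
  rw [← integral_quadratic_stdGaussian hB t, multivariateGaussian, integral_map]
  · have h1 : (R * S).trace = (q * S * q).trace := by
      rw [← hqq, Matrix.trace_mul_comm (q * S), Matrix.mul_assoc]
    have h2 : ∀ y : EuclideanSpace ℝ ι, (0 + toEuclideanCLM (𝕜 := ℝ) q y).ofLp ⬝ᵥ
        S *ᵥ (0 + toEuclideanCLM (𝕜 := ℝ) q y).ofLp = y.ofLp ⬝ᵥ (q * S * q) *ᵥ y.ofLp := by
      intro y
      rw [zero_add, ofLp_toEuclideanCLM, Matrix.dotProduct_mulVec, Matrix.vecMul_mulVec, hqt,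
        ← Matrix.dotProduct_mulVec, Matrix.mulVec_mulVec]
    simp only [h1, ← hq, h2]
  · fun_prop
  · refine Continuous.aestronglyMeasurable ?_
    simp only [dotProduct, mulVec]
    fun_prop

lemma trace_sqrt_form {κ : Type*} [Fintype κ] {q R S : Matrix κ κ ℝ} (hqq : q * q = R) :
    ((q * S * q) * (q * S * q)).trace = (R * S * R * S).trace := by
  calc _ = (q * (S * (q * q) * S * q)).trace := by simp only [Matrix.mul_assoc]
    _ = (S * (q * q) * S * q * q).trace := Matrix.trace_mul_comm _ _
    _ = ((S * (q * q)) * (S * (q * q))).trace := by simp only [Matrix.mul_assoc]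
    _ = _ := by
      rw [hqq, Matrix.trace_mul_comm, Matrix.mul_assoc, Matrix.trace_mul_comm]
      simp only [Matrix.mul_assoc]

attribute [local instance] Matrix.linftyOpNormedRing Matrix.linftyOpNormedAlgebra

/-- The central limit theorem for quadratic forms in Gaussian vectors, uniformly over matrices with
bounded row sums: no eigenvalue of the form dominates. -/
lemma quadratic_charFun_sub_exp_le (p : ℕ) (C : ℝ) {ε : ℝ} (hε : 0 < ε) :
    ∃ N : ℕ, ∀ n, N ≤ n → ∀ R S : Matrix (Fin n × Fin p) (Fin n × Fin p) ℝ, R.PosSemidef →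
      S.IsHermitian → ‖S‖ * ‖R‖ ≤ C →
      ‖∫ z, Complex.exp (((√n)⁻¹ * (z.ofLp ⬝ᵥ S *ᵥ z.ofLp - (R * S).trace) : ℝ) * Complex.I)
        ∂multivariateGaussian 0 R - Complex.exp (-((n : ℝ)⁻¹ * (R * S * R * S).trace : ℝ))‖
          ≤ ε := by
  set D : ℝ := p * C ^ 2 + 1 with hD
  have hD0 : 0 < D := by positivity
  obtain ⟨δ, hδ, h⟩ := prod_chiChar_sub_exp_le (ε := ε / D) (by positivity)
  obtain ⟨N, hN⟩ := exists_nat_gt ((C / δ) ^ 2)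
  refine ⟨N + 1, fun n hn R S hR hS hRS => ?_⟩
  obtain ⟨q, hB, hqq, hint⟩ := exists_integral_quadratic_multivariateGaussian hR hS
  have hn0 : (0 : ℝ) < n := by exact_mod_cast (by omega : 0 < n)
  have hsn : 0 < √(n : ℝ) := Real.sqrt_pos.2 hn0
  have hsq : √(n : ℝ) ^ 2 = n := Real.sq_sqrt hn0.le
  have hμ : ∀ i, |hB.eigenvalues i| ≤ C := fun i =>
    (abs_eigenvalues_le hB i).trans (by rw [hqq]; exact hRS)
  have hsum : ∑ i, ((√(n : ℝ))⁻¹ * hB.eigenvalues i) ^ 2 = (n : ℝ)⁻¹ * (R * S * R * S).trace := by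
    rw [← trace_sqrt_form hqq, trace_mul_self_eq_sum_eigenvalues hB, Finset.mul_sum]
    refine Finset.sum_congr rfl fun i _ => ?_
    rw [mul_pow, inv_pow, hsq]
  have hle : ∑ i, ((√(n : ℝ))⁻¹ * hB.eigenvalues i) ^ 2 ≤ D := by
    have h1 : ∀ i, ((√(n : ℝ))⁻¹ * hB.eigenvalues i) ^ 2 ≤ (n : ℝ)⁻¹ * C ^ 2 := by
      intro i
      rw [mul_pow, inv_pow, hsq, ← sq_abs (hB.eigenvalues i)]
      gcongr
      exact hμ i
    refine (Finset.sum_le_card_nsmul _ _ _ fun i _ => h1 i).trans ?_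
    simp only [Finset.card_univ, Fintype.card_prod, Fintype.card_fin, nsmul_eq_mul, Nat.cast_mul]
    have : (n : ℝ) * p * ((n : ℝ)⁻¹ * C ^ 2) = p * C ^ 2 := by field_simp
    rw [this]; linarith
  rw [hint, ← hsum]
  refine (h _ fun i => ?_).trans ?_
  · rw [abs_mul, abs_inv, abs_of_pos hsn, inv_mul_le_iff₀ hsn]
    refine (hμ i).trans ?_
    have h2 : C / δ ≤ √(n : ℝ) := by
      refine Real.le_sqrt_of_sq_le (hN.le.trans ?_)
      exact_mod_cast (by omega : N ≤ n)
    rw [div_le_iff₀ hδ] at h2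
    exact h2
  · calc ε / D * _ ≤ ε / D * D := by gcongr
      _ = ε := by field_simp

end GaussianForm

/-! ### The law of the latent field at the observation points -/

section Latent

open Matrix

variable {Ω : Type*} [MeasurableSpace Ω] {P : Measure Ω} {d p n : ℕ}
  {Z : Fin p → Loc d → Ω → ℝ}

/-- The vector of all `Z_k(s_i)`, indexed by `(i, k)`. -/
def latentVec (s : Fin n → Loc d) (Z : Fin p → Loc d → Ω → ℝ) (ω : Ω) :
    EuclideanSpace ℝ (Fin n × Fin p) :=
  WithLp.toLp 2 fun a => Z a.2 (s a.1) ω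

lemma hasGaussianLaw_latentVec (hgauss : ∀ k, IsGaussianProcess (Z k) P)
    (hindep : iIndepFun (fun (k : Fin p) (ω : Ω) (x : Loc d) => Z k x ω) P) (s : Fin n → Loc d) :
    HasGaussianLaw (latentVec s Z) P := by
  have h1 : ∀ k, HasGaussianLaw (fun ω (i : Fin n) => Z k (s i) ω) P := by
    intro k
    have h2 := ((hgauss k).comp_right s).hasGaussianLaw Finset.univ
    let L : ({i // i ∈ (Finset.univ : Finset (Fin n))} → ℝ) →L[ℝ] (Fin n → ℝ) :=
      ContinuousLinearMap.pi fun i => ContinuousLinearMap.proj ⟨i, Finset.mem_univ i⟩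
    exact h2.map_fun L
  have h3 : iIndepFun (fun (k : Fin p) (ω : Ω) (i : Fin n) => Z k (s i) ω) P :=
    hindep.comp (fun k (z : Loc d → ℝ) (i : Fin n) => z (s i)) fun k => by fun_prop
  have h4 := iIndepFun.hasGaussianLaw h1 h3
  let L : (Fin p → Fin n → ℝ) →L[ℝ] EuclideanSpace ℝ (Fin n × Fin p) :=
    ((EuclideanSpace.equiv (Fin n × Fin p) ℝ).symm : (Fin n × Fin p → ℝ) →L[ℝ] _) ∘L
      ContinuousLinearMap.pi fun a =>
        (ContinuousLinearMap.proj a.1 : (Fin n → ℝ) →L[ℝ] ℝ).comp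
          (ContinuousLinearMap.proj a.2 : (Fin p → Fin n → ℝ) →L[ℝ] (Fin n → ℝ))
  exact h4.map_fun L

variable [IsProbabilityMeasure P]

lemma covarianceBilin_latentVec (hgauss : ∀ k, IsGaussianProcess (Z k) P) (s : Fin n → Loc d)
    (x y : EuclideanSpace ℝ (Fin n × Fin p)) :
    covarianceBilin (P.map (latentVec s Z)) x y = x.ofLp ⬝ᵥ latentCov P s Z *ᵥ y.ofLp := by
  have h := covarianceBilin_apply_pi (μ := P) (X := fun a : Fin n × Fin p => Z a.2 (s a.1))
    (fun a => ((hgauss a.2).hasGaussianLaw_eval (s a.1)).memLp_two) x y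
  refine h.trans ?_
  simp only [dotProduct, mulVec, latentCov, Matrix.of_apply, Finset.mul_sum]
  refine Finset.sum_congr rfl fun a _ => Finset.sum_congr rfl fun b _ => ?_
  ring

lemma posSemidef_latentCov (hgauss : ∀ k, IsGaussianProcess (Z k) P) (s : Fin n → Loc d) :
    (latentCov P s Z).PosSemidef := by
  refine Matrix.PosSemidef.of_dotProduct_mulVec_nonneg ?_ fun x => ?_
  · ext a b
    simp [latentCov, covariance_comm]
  · have := covarianceBilin_latentVec hgauss s (WithLp.toLp 2 x) (WithLp.toLp 2 x)
    have h2 := covarianceBilin_self_nonneg (μ := P.map (latentVec s Z)) (WithLp.toLp 2 x)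
    rw [this] at h2
    simpa using h2

lemma map_latentVec (hmean : ∀ k x, ∫ ω, Z k x ω ∂P = 0)
    (hgauss : ∀ k, IsGaussianProcess (Z k) P)
    (hindep : iIndepFun (fun (k : Fin p) (ω : Ω) (x : Loc d) => Z k x ω) P) (s : Fin n → Loc d) :
    P.map (latentVec s Z) = multivariateGaussian 0 (latentCov P s Z) := by
  have hl := hasGaussianLaw_latentVec hgauss hindep s
  have := hl.isGaussian_map
  refine IsGaussian.ext ?_ ?_
  · simp only [id, integral_id_multivariateGaussian]
    rw [integral_map hl.aemeasurable (by fun_prop)]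
    have hint := hl.integrable
    ext a
    have h1 := (EuclideanSpace.proj (𝕜 := ℝ) a).integral_comp_comm hint
    refine h1.symm.trans ?_
    simpa [latentVec] using hmean a.2 (s a.1)
  · ext x y
    rw [covarianceBilin_latentVec hgauss,
      covarianceBilin_multivariateGaussian (posSemidef_latentCov hgauss s)]

end Latent

/-! ### Local covariance matrices of the latent field -/

section LocalCov

open Matrix

variable {Ω : Type*} {d p n : ℕ} {Z : Fin p → Loc d → Ω → ℝ}

/-- The empirical local covariance matrix of the latent field itself. -/
noncomputable def latentEmp (s : Fin n → Loc d) (g : Loc d → ℝ) (Z : Fin p → Loc d → Ω → ℝ)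
    (ω : Ω) : Matrix (Fin p) (Fin p) ℝ :=
  empCov s g (fun x ω k => Z k x ω) ω

lemma latentEmp_apply (s : Fin n → Loc d) (g : Loc d → ℝ) (ω : Ω) (b l : Fin p) :
    latentEmp s g Z ω b l =
      (n : ℝ)⁻¹ * ∑ i, ∑ j, g (s i - s j) * (Z b (s i) ω * Z l (s j) ω) := by
  simp [latentEmp, empCov, Matrix.sum_apply, Matrix.vecMulVec_apply]

lemma empCov_mix (Om : Matrix (Fin p) (Fin p) ℝ) (s : Fin n → Loc d) (g : Loc d → ℝ) (ω : Ω) :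
    empCov s g (mix Om Z) ω = Om * latentEmp s g Z ω * Omᵀ := by
  have h : ∀ v w : Fin p → ℝ, vecMulVec (Om *ᵥ v) (Om *ᵥ w) = Om * vecMulVec v w * Omᵀ := by
    intro v w
    rw [Matrix.mul_vecMulVec, Matrix.vecMulVec_mul, Matrix.vecMul_transpose]
  simp only [latentEmp, empCov, mix, h, Matrix.mul_smul, Matrix.smul_mul, Matrix.mul_sum,
    Matrix.sum_mul]

lemma transpose_latentEmp {s : Fin n → Loc d} {g : Loc d → ℝ}
    (hg : ∀ i j, g (s i - s j) = g (s j - s i)) (ω : Ω) :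
    (latentEmp s g Z ω)ᵀ = latentEmp s g Z ω := by
  ext b l
  rw [transpose_apply, latentEmp_apply, latentEmp_apply, Finset.sum_comm]
  congr 1
  refine Finset.sum_congr rfl fun i _ => Finset.sum_congr rfl fun j _ => ?_
  rw [hg j i]; ring

lemma blockT_apply (s : Fin n → Loc d) (g : Loc d → ℝ) (b l : Fin p) (x y : Fin n × Fin p) :
    blockT s g b l x y = g (s x.1 - s y.1) * (1 / 2 *
      ((if b = x.2 ∧ l = y.2 then 1 else 0) + (if l = x.2 ∧ b = y.2 then 1 else 0))) := by
  simp [blockT, Matrix.single_apply]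

lemma isHermitian_blockT {s : Fin n → Loc d} {g : Loc d → ℝ}
    (hg : ∀ i j, g (s i - s j) = g (s j - s i)) (b l : Fin p) : (blockT s g b l).IsHermitian := by
  ext x y
  rw [conjTranspose_apply, star_trivial, blockT_apply, blockT_apply, hg y.1 x.1]
  congr 2
  rw [add_comm]
  simp only [and_comm]

/-- Summing a block pattern against a function of pairs. -/
lemma sum_single_pair (b l : Fin p) (F : Fin p → Fin p → ℝ) :
    ∑ k, ∑ m, (if b = k ∧ l = m then (1 : ℝ) else 0) * F k m = F b l := by
  simp only [ite_and, ite_mul, one_mul, zero_mul]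
  simp

/-- The entries of the empirical local covariance matrix are quadratic forms in the latent vector.
-/
lemma dotProduct_blockT {s : Fin n → Loc d} {g : Loc d → ℝ}
    (hg : ∀ i j, g (s i - s j) = g (s j - s i)) (b l : Fin p) (ω : Ω) :
    (n : ℝ)⁻¹ * ((latentVec s Z ω).ofLp ⬝ᵥ blockT s g b l *ᵥ (latentVec s Z ω).ofLp) =
      latentEmp s g Z ω b l := by
  rw [latentEmp_apply]
  congr 1
  have h1 : (latentVec s Z ω).ofLp ⬝ᵥ blockT s g b l *ᵥ (latentVec s Z ω).ofLp =
      ∑ i, ∑ j, g (s i - s j) *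
        (1 / 2 * (Z b (s i) ω * Z l (s j) ω + Z l (s i) ω * Z b (s j) ω)) := by
    simp only [dotProduct, mulVec, Finset.mul_sum, Fintype.sum_prod_type, latentVec, blockT_apply]
    refine Finset.sum_congr rfl fun i _ => ?_
    rw [Finset.sum_comm]
    refine Finset.sum_congr rfl fun j _ => ?_
    rw [← sum_single_pair b l fun k m => Z k (s i) ω * Z m (s j) ω,
      ← sum_single_pair l b fun k m => Z k (s i) ω * Z m (s j) ω, ← Finset.sum_add_distrib]
    simp only [← Finset.sum_add_distrib, Finset.mul_sum]
    refine Finset.sum_congr rfl fun k _ => Finset.sum_congr rfl fun m _ => ?_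
    ring
  have h2 : ∑ i, ∑ j, g (s i - s j) * (Z l (s i) ω * Z b (s j) ω) =
      ∑ i, ∑ j, g (s i - s j) * (Z b (s i) ω * Z l (s j) ω) := by
    rw [Finset.sum_comm]
    refine Finset.sum_congr rfl fun i _ => Finset.sum_congr rfl fun j _ => ?_
    rw [hg j i]; ring
  have h3 : ∑ i, ∑ j, g (s i - s j) *
        (1 / 2 * (Z b (s i) ω * Z l (s j) ω + Z l (s i) ω * Z b (s j) ω)) =
      1 / 2 * (∑ i, ∑ j, g (s i - s j) * (Z b (s i) ω * Z l (s j) ω)) +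
      1 / 2 * (∑ i, ∑ j, g (s i - s j) * (Z l (s i) ω * Z b (s j) ω)) := by
    simp only [Finset.mul_sum, ← Finset.sum_add_distrib]
    refine Finset.sum_congr rfl fun i _ => Finset.sum_congr rfl fun j _ => ?_
    ring
  rw [h1, h3, h2]; ring

variable [MeasurableSpace Ω] {P : Measure Ω}

/-- The diagonal elements of the population local covariance matrix of the latent field, which is
a diagonal matrix since the coordinates of the field are uncorrelated. -/
noncomputable def latentLam (P : Measure Ω) (s : Fin n → Loc d) (g : Loc d → ℝ)
    (Z : Fin p → Loc d → Ω → ℝ) (k : Fin p) : ℝ :=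
  (n : ℝ)⁻¹ * ∑ i, ∑ j, g (s i - s j) * cov[Z k (s i), Z k (s j); P]

lemma trace_latentCov_mul_blockT (hcov0 : ∀ k l x y, k ≠ l → cov[Z k x, Z l y; P] = 0)
    {s : Fin n → Loc d} {g : Loc d → ℝ} (hg : ∀ i j, g (s i - s j) = g (s j - s i)) (b l : Fin p) :
    (n : ℝ)⁻¹ * (latentCov P s Z * blockT s g b l).trace =
      diagonal (latentLam P s g Z) b l := by
  have h1 : (latentCov P s Z * blockT s g b l).trace = ∑ i, ∑ j, g (s i - s j) *
      (1 / 2 * (cov[Z l (s i), Z b (s j); P] + cov[Z b (s i), Z l (s j); P])) := by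
    simp only [Matrix.trace, Matrix.diag, Matrix.mul_apply, Fintype.sum_prod_type, latentCov,
      blockT_apply, Matrix.of_apply]
    refine Finset.sum_congr rfl fun i _ => ?_
    rw [Finset.sum_comm]
    refine Finset.sum_congr rfl fun j _ => ?_
    rw [← sum_single_pair l b fun k m => cov[Z k (s i), Z m (s j); P],
      ← sum_single_pair b l fun k m => cov[Z k (s i), Z m (s j); P], ← Finset.sum_add_distrib]
    simp only [← Finset.sum_add_distrib, Finset.mul_sum]
    refine Finset.sum_congr rfl fun k _ => Finset.sum_congr rfl fun m _ => ?_
    rw [hg j i]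
    simp only [and_comm]
    ring
  rw [h1]
  by_cases hbl : b = l
  · subst hbl
    rw [diagonal_apply_eq, latentLam]
    congr 1
    refine Finset.sum_congr rfl fun i _ => Finset.sum_congr rfl fun j _ => ?_
    ring
  · rw [diagonal_apply_ne _ hbl]
    simp [hcov0 _ _ _ _ hbl, hcov0 _ _ _ _ (Ne.symm hbl)]

lemma kernelZero_sub {s : Fin n → Loc d} (hs : Function.Injective s) (i j : Fin n) :
    kernelZero d (s i - s j) = if i = j then 1 else 0 := by
  by_cases h : i = j
  · simp [h, kernelZero]
  · rw [if_neg h, kernelZero, Set.indicator_of_notMem]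
    simpa [sub_eq_zero] using hs.ne h

lemma latentLam_kernelZero (hunit : ∀ k x, cov[Z k x, Z k x; P] = 1) (hn : 1 ≤ n)
    {s : Fin n → Loc d} (hs : Function.Injective s) :
    latentLam P s (kernelZero d) Z = fun _ => 1 := by
  ext k
  have hn0 : (n : ℝ) ≠ 0 := by exact_mod_cast (by omega : n ≠ 0)
  simp [latentLam, kernelZero_sub hs, hunit, hn0]

variable [IsProbabilityMeasure P]

lemma popCov_mix (hmean : ∀ k x, ∫ ω, Z k x ω ∂P = 0) (hgauss : ∀ k, IsGaussianProcess (Z k) P)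
    (hcov0 : ∀ k l x y, k ≠ l → cov[Z k x, Z l y; P] = 0) (Om : Matrix (Fin p) (Fin p) ℝ)
    (s : Fin n → Loc d) (g : Loc d → ℝ) :
    popCov P s g (mix Om Z) = Om * diagonal (latentLam P s g Z) * Omᵀ := by
  have hL2 : ∀ k x, MemLp (Z k x) 2 P := fun k x => ((hgauss k).hasGaussianLaw_eval x).memLp_two
  have hcov : ∀ k l x y, ∫ ω, Z k x ω * Z l y ω ∂P = cov[Z k x, Z l y; P] := by
    intro k l x y
    rw [covariance_eq_sub (hL2 k x) (hL2 l y), hmean]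
    simp
  have hint : ∀ k l x y, Integrable (fun ω => Z k x ω * Z l y ω) P := fun k l x y =>
    (hL2 k x).integrable_mul (hL2 l y)
  have h1 : ∀ x y, (Matrix.of fun a b => ∫ ω, mix Om Z x ω a * mix Om Z y ω b ∂P) =
      Om * (diagonal fun k => cov[Z k x, Z k y; P]) * Omᵀ := by
    intro x y
    ext a b
    simp only [Matrix.of_apply, mix, mulVec, dotProduct, Finset.sum_mul_sum]
    have h2 : ∀ k l ω, Om a k * Z k x ω * (Om b l * Z l y ω) =
        Om a k * Om b l * (Z k x ω * Z l y ω) := by intros; ring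
    simp only [h2]
    rw [integral_finsetSum _ fun k _ =>
      integrable_finsetSum _ fun l _ => (hint k l x y).const_mul _]
    rw [Matrix.mul_apply]
    refine Finset.sum_congr rfl fun k _ => ?_
    rw [integral_finsetSum _ fun l _ => (hint k l x y).const_mul _]
    simp only [integral_const_mul, hcov, mul_diagonal, transpose_apply]
    rw [Finset.sum_eq_single k (fun l _ hl => by rw [hcov0 _ _ _ _ hl.symm, mul_zero]) (by simp)]
    ring
  have h3 : diagonal (latentLam P s g Z) =
      (n : ℝ)⁻¹ • ∑ i, ∑ j, g (s i - s j) • diagonal fun k => cov[Z k (s i), Z k (s j); P] := by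
    ext a b
    by_cases hab : a = b
    · subst hab
      simp [latentLam, Matrix.sum_apply]
    · simp [Matrix.sum_apply, hab]
  rw [h3]
  simp only [popCov, h1, Matrix.mul_smul, Matrix.smul_mul, Matrix.mul_sum, Matrix.sum_mul]

end LocalCov

/-! ### The asymptotic covariance matrix -/

section Forms

open Matrix

variable {d p n : ℕ}

/-- The matrices of the quadratic forms that make up the two empirical local covariance matrices,
indexed like the coordinates of `vMat`. -/
noncomputable def pairT (s : Fin n → Loc d) (f g : Loc d → ℝ) :
    Pos p ⊕ Pos p → Matrix (Fin n × Fin p) (Fin n × Fin p) ℝ :=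
  Sum.elim (fun u => blockT s f u.1 u.2) (fun u => blockT s g u.1 u.2)

/-- The matrix of a linear combination of these quadratic forms. -/
noncomputable def combT (s : Fin n → Loc d) (f g : Loc d → ℝ) (a : Pos p ⊕ Pos p → ℝ) :
    Matrix (Fin n × Fin p) (Fin n × Fin p) ℝ :=
  ∑ c, a c • pairT s f g c

variable {R : Matrix (Fin n × Fin p) (Fin n × Fin p) ℝ} {s : Fin n → Loc d} {f g : Loc d → ℝ}

lemma isHermitian_pairT (hf : ∀ i j, f (s i - s j) = f (s j - s i))
    (hg : ∀ i j, g (s i - s j) = g (s j - s i)) (c : Pos p ⊕ Pos p) :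
    (pairT s f g c).IsHermitian := by
  rcases c with c | c
  · exact isHermitian_blockT hf _ _
  · exact isHermitian_blockT hg _ _

lemma isHermitian_combT (hf : ∀ i j, f (s i - s j) = f (s j - s i))
    (hg : ∀ i j, g (s i - s j) = g (s j - s i)) (a : Pos p ⊕ Pos p → ℝ) :
    (combT s f g a).IsHermitian := by
  rw [IsHermitian, combT, conjTranspose_sum]
  refine Finset.sum_congr rfl fun c _ => ?_
  rw [conjTranspose_smul, star_trivial, (isHermitian_pairT hf hg c).eq]

lemma vMat_apply (c c' : Pos p ⊕ Pos p) :
    vMat R s f g c c' = 2 * (n : ℝ)⁻¹ * (R * pairT s f g c * R * pairT s f g c').trace := by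
  rcases c with c | c <;> rcases c' with c' | c' <;> simp [vMat, sigmaMat, pairT]

lemma dotProduct_vMat (a b : Pos p ⊕ Pos p → ℝ) :
    a ⬝ᵥ vMat R s f g *ᵥ b =
      2 * (n : ℝ)⁻¹ * (R * combT s f g a * R * combT s f g b).trace := by
  simp only [dotProduct, mulVec, vMat_apply, combT, Matrix.sum_mul,
    Matrix.trace_sum, Matrix.mul_smul, Matrix.smul_mul, Matrix.trace_smul, smul_eq_mul,
    Finset.mul_sum]
  rw [Finset.sum_comm]
  refine Finset.sum_congr rfl fun c _ => Finset.sum_congr rfl fun c' _ => ?_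
  ring

lemma trace_form_nonneg {S : Matrix (Fin n × Fin p) (Fin n × Fin p) ℝ} (hR : R.PosSemidef)
    (hS : S.IsHermitian) : 0 ≤ (R * S * R * S).trace := by
  obtain ⟨q, hB, hqq, -⟩ := exists_integral_quadratic_multivariateGaussian hR hS
  rw [← trace_sqrt_form hqq, trace_mul_self_eq_sum_eigenvalues hB]
  exact Finset.sum_nonneg fun i _ => sq_nonneg _

lemma posSemidef_vMat (hR : R.PosSemidef) (hf : ∀ i j, f (s i - s j) = f (s j - s i))
    (hg : ∀ i j, g (s i - s j) = g (s j - s i)) : (vMat R s f g : Matrix _ _ ℝ).PosSemidef := by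
  refine Matrix.PosSemidef.of_dotProduct_mulVec_nonneg ?_ fun a => ?_
  · ext c c'
    rw [conjTranspose_apply, star_trivial, vMat_apply, vMat_apply, Matrix.mul_assoc,
      Matrix.trace_mul_comm]
    simp only [Matrix.mul_assoc]
  · rw [star_trivial, dotProduct_vMat]
    have := trace_form_nonneg hR (isHermitian_combT (p := p) hf hg a)
    positivity

attribute [local instance] Matrix.linftyOpNormedRing Matrix.linftyOpNormedAlgebra

lemma norm_combT_le {C : ℝ} (hC : ∀ c : Pos p ⊕ Pos p, ‖pairT s f g c‖ ≤ C)
    (a : Pos p ⊕ Pos p → ℝ) : ‖combT s f g a‖ ≤ (∑ c, |a c|) * C := by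
  rw [combT, Finset.sum_mul]
  refine (norm_sum_le _ _).trans (Finset.sum_le_sum fun c _ => ?_)
  rw [norm_smul, Real.norm_eq_abs]
  gcongr
  exact hC c

lemma abs_inv_mul_trace_le (A : Matrix (Fin n × Fin p) (Fin n × Fin p) ℝ) :
    |(n : ℝ)⁻¹ * A.trace| ≤ p * ‖A‖ := by
  rw [abs_mul, abs_of_nonneg (by positivity)]
  have h1 := abs_trace_le A
  rcases Nat.eq_zero_or_pos n with rfl | hn
  · simp; positivity
  · have hn0 : (0 : ℝ) < n := by exact_mod_cast hn
    rw [inv_mul_le_iff₀ hn0]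
    refine h1.trans_eq ?_
    simp [mul_assoc]

lemma abs_vMat_le {B C : ℝ} (hB : ‖R‖ ≤ B) (hC : ∀ c : Pos p ⊕ Pos p, ‖pairT s f g c‖ ≤ C)
    (c c' : Pos p ⊕ Pos p) : |vMat R s f g c c'| ≤ 2 * (p * (B * C * B * C)) := by
  have hB0 : 0 ≤ B := (norm_nonneg _).trans hB
  have hC0 : 0 ≤ C := (norm_nonneg _).trans (hC c)
  rw [vMat_apply, mul_assoc, abs_mul, abs_of_pos (by norm_num : (0 : ℝ) < 2)]
  gcongr
  refine (abs_inv_mul_trace_le _).trans ?_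
  gcongr
  refine (norm_mul_le _ _).trans ?_
  gcongr
  · refine (norm_mul_le _ _).trans ?_
    gcongr
    refine (norm_mul_le _ _).trans ?_
    gcongr
    exact hC c
  · exact hC c'

lemma norm_blockT_le {B r A : ℝ} (hA : 0 ≤ A) (hg : ∀ x, |g x| ≤ A / (1 + ‖x‖ ^ r))
    (hs : ∀ i, ∑ j, (1 + ‖s i - s j‖ ^ r)⁻¹ ≤ B) (hB : 0 ≤ B) (b l : Fin p) :
    ‖blockT s g b l‖ ≤ A * B := by
  refine linfty_opNorm_le (by positivity) fun x => ?_
  have h1 : ∀ j, ∑ m, |blockT s g b l x (j, m)| ≤ A * (1 + ‖s x.1 - s j‖ ^ r)⁻¹ := by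
    intro j
    have h2 : ∀ m, |blockT s g b l x (j, m)| ≤ |g (s x.1 - s j)| * (1 / 2 *
        ((if l = m then 1 else 0) + (if b = m then 1 else 0))) := by
      intro m
      rw [blockT_apply, abs_mul]
      gcongr
      rw [abs_of_nonneg (by positivity)]
      gcongr
      · split_ifs with h3 h4 <;> first | exact le_rfl | exact zero_le_one | exact absurd h3.2 h4
      · split_ifs with h3 h4 <;> first | exact le_rfl | exact zero_le_one | exact absurd h3.2 h4
    refine (Finset.sum_le_sum fun m _ => h2 m).trans ?_
    rw [← Finset.mul_sum, ← Finset.mul_sum, Finset.sum_add_distrib]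
    simp only [Finset.sum_ite_eq, Finset.mem_univ, if_true]
    calc _ = |g (s x.1 - s j)| := by ring
      _ ≤ _ := (hg _).trans_eq (div_eq_mul_inv _ _)
  rw [Fintype.sum_prod_type]
  refine (Finset.sum_le_sum fun j _ => h1 j).trans ?_
  rw [← Finset.mul_sum]
  gcongr
  exact hs x.1

end Forms

/-! ### Asymptotic normality of the empirical local covariance matrices -/

section Normality

open Matrix

variable {Ω : Type*} [MeasurableSpace Ω] {P : Measure Ω} {d p n : ℕ}
  {Z : Fin p → Loc d → Ω → ℝ} {s : Fin n → Loc d} {f g : Loc d → ℝ}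

/-- `n^{1/2}` times the deviations of the two empirical local covariance matrices of the latent
field, for the kernels `f` and `g`, from their means, as one vector. -/
noncomputable def errVec (P : Measure Ω) (s : Fin n → Loc d) (f g : Loc d → ℝ)
    (Z : Fin p → Loc d → Ω → ℝ) (ω : Ω) : EuclideanSpace ℝ (Pos p ⊕ Pos p) :=
  WithLp.toLp 2 (Sum.elim
    (fun u => √(n : ℝ) * (latentEmp s f Z ω - diagonal (latentLam P s f Z)) u.1 u.2)
    (fun u => √(n : ℝ) * (latentEmp s g Z ω - diagonal (latentLam P s g Z)) u.1 u.2))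

lemma aemeasurable_latentEmp (hgauss : ∀ k, IsGaussianProcess (Z k) P) (b l : Fin p) :
    AEMeasurable (fun ω => latentEmp s g Z ω b l) P := by
  have : ∀ k x, AEMeasurable (Z k x) P := fun k x => (hgauss k).aemeasurable x
  simp only [latentEmp_apply]
  fun_prop

lemma aemeasurable_errVec (hgauss : ∀ k, IsGaussianProcess (Z k) P) :
    AEMeasurable (errVec P s f g Z) P := by
  have h : AEMeasurable (fun ω (c : Pos p ⊕ Pos p) => errVec P s f g Z ω c) P := by
    refine aemeasurable_pi_lambda _ fun c => ?_
    rcases c with c | c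
    · exact ((aemeasurable_latentEmp hgauss c.1 c.2).sub_const _).const_mul _
    · exact ((aemeasurable_latentEmp hgauss c.1 c.2).sub_const _).const_mul _
  exact (by fun_prop : Measurable (WithLp.toLp 2 : (Pos p ⊕ Pos p → ℝ) → _)).comp_aemeasurable h

lemma errVec_apply (hcov0 : ∀ k l x y, k ≠ l → cov[Z k x, Z l y; P] = 0)
    (hf : ∀ i j, f (s i - s j) = f (s j - s i)) (hg : ∀ i j, g (s i - s j) = g (s j - s i))
    (ω : Ω) (c : Pos p ⊕ Pos p) :
    errVec P s f g Z ω c = (√(n : ℝ))⁻¹ *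
      ((latentVec s Z ω).ofLp ⬝ᵥ pairT s f g c *ᵥ (latentVec s Z ω).ofLp -
        (latentCov P s Z * pairT s f g c).trace) := by
  have hsq : (√(n : ℝ))⁻¹ = √(n : ℝ) * (n : ℝ)⁻¹ := by
    rw [← Real.sqrt_div_self, div_eq_mul_inv]
  rw [hsq, mul_assoc, mul_sub]
  rcases c with c | c
  · simp only [pairT, Sum.elim_inl]
    rw [dotProduct_blockT hf, trace_latentCov_mul_blockT hcov0 hf]
    rfl
  · simp only [pairT, Sum.elim_inr]
    rw [dotProduct_blockT hg, trace_latentCov_mul_blockT hcov0 hg]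
    rfl

lemma inner_errVec (hcov0 : ∀ k l x y, k ≠ l → cov[Z k x, Z l y; P] = 0)
    (hf : ∀ i j, f (s i - s j) = f (s j - s i)) (hg : ∀ i j, g (s i - s j) = g (s j - s i))
    (ω : Ω) (a : EuclideanSpace ℝ (Pos p ⊕ Pos p)) :
    inner ℝ (errVec P s f g Z ω) a = (√(n : ℝ))⁻¹ *
      ((latentVec s Z ω).ofLp ⬝ᵥ combT s f g a.ofLp *ᵥ (latentVec s Z ω).ofLp -
        (latentCov P s Z * combT s f g a.ofLp).trace) := by
  rw [PiLp.inner_apply]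
  simp only [errVec_apply hcov0 hf hg, combT, Matrix.trace_sum, Matrix.sum_mulVec,
    dotProduct_sum, ← Finset.sum_sub_distrib, Finset.mul_sum]
  refine Finset.sum_congr rfl fun c _ => ?_
  simp only [Matrix.mul_smul, Matrix.trace_smul, Matrix.smul_mulVec, dotProduct_smul, smul_eq_mul,
    RCLike.inner_apply, conj_trivial]
  ring

variable [IsProbabilityMeasure P]

lemma charFun_errVec (hmean : ∀ k x, ∫ ω, Z k x ω ∂P = 0)
    (hgauss : ∀ k, IsGaussianProcess (Z k) P)
    (hindep : iIndepFun (fun (k : Fin p) (ω : Ω) (x : Loc d) => Z k x ω) P)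
    (hcov0 : ∀ k l x y, k ≠ l → cov[Z k x, Z l y; P] = 0)
    (hf : ∀ i j, f (s i - s j) = f (s j - s i)) (hg : ∀ i j, g (s i - s j) = g (s j - s i))
    (a : EuclideanSpace ℝ (Pos p ⊕ Pos p)) :
    charFun (P.map (errVec P s f g Z)) a =
      ∫ z, Complex.exp (((√n)⁻¹ * (z.ofLp ⬝ᵥ combT s f g a.ofLp *ᵥ z.ofLp -
        (latentCov P s Z * combT s f g a.ofLp).trace) : ℝ) * Complex.I)
        ∂multivariateGaussian 0 (latentCov P s Z) := by
  rw [charFun_apply, integral_map (aemeasurable_errVec hgauss) (by fun_prop)]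
  simp only [inner_errVec hcov0 hf hg]
  rw [← map_latentVec hmean hgauss hindep, integral_map
    (hasGaussianLaw_latentVec hgauss hindep s).aemeasurable]
  refine Continuous.aestronglyMeasurable ?_
  simp only [dotProduct, mulVec]
  fun_prop

attribute [local instance] Matrix.linftyOpNormedRing Matrix.linftyOpNormedAlgebra

/-- The normalised errors are asymptotically normal with covariance matrix `V(f, g)`. As this matrix
need not converge, the characteristic functions are compared for each `n`. -/
lemma tendsto_charFun_errVec_sub {s : (n : ℕ) → Fin n → Loc d}
    (hmean : ∀ k x, ∫ ω, Z k x ω ∂P = 0) (hgauss : ∀ k, IsGaussianProcess (Z k) P)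
    (hindep : iIndepFun (fun (k : Fin p) (ω : Ω) (x : Loc d) => Z k x ω) P)
    (hcov0 : ∀ k l x y, k ≠ l → cov[Z k x, Z l y; P] = 0)
    (hf : ∀ n (i j : Fin n), f (s n i - s n j) = f (s n j - s n i))
    (hg : ∀ n (i j : Fin n), g (s n i - s n j) = g (s n j - s n i))
    {B C : ℝ} (hB : ∀ n, ‖latentCov P (s n) Z‖ ≤ B)
    (hC : ∀ n (c : Pos p ⊕ Pos p), ‖pairT (s n) f g c‖ ≤ C)
    (a : EuclideanSpace ℝ (Pos p ⊕ Pos p)) :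
    Tendsto (fun n => charFun (P.map (errVec P (s n) f g Z)) a -
      Complex.exp (-(a.ofLp ⬝ᵥ vMat (latentCov P (s n) Z) (s n) f g *ᵥ a.ofLp / 2 : ℝ)))
      atTop (𝓝 0) := by
  refine Metric.tendsto_atTop.2 fun ε hε => ?_
  obtain ⟨N, hN⟩ := quadratic_charFun_sub_exp_le p ((∑ c, |a c|) * C * B) (half_pos hε)
  refine ⟨N, fun n hn => ?_⟩
  rw [dist_zero_right, charFun_errVec hmean hgauss hindep hcov0 (hf n) (hg n), dotProduct_vMat]
  refine lt_of_le_of_lt ?_ (half_lt_self hε)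
  have h1 := norm_combT_le (hC n) a.ofLp
  have h2 := (norm_nonneg _).trans h1
  have h3 : ‖combT (s n) f g a.ofLp‖ * ‖latentCov P (s n) Z‖ ≤ (∑ c, |a c|) * C * B := by
    gcongr
    exact hB n
  have h4 : ∀ u : ℝ, 2 * (n : ℝ)⁻¹ * u / 2 = (n : ℝ)⁻¹ * u := fun u => by ring
  rw [h4]
  exact hN n hn (latentCov P (s n) Z) (combT (s n) f g a.ofLp) (posSemidef_latentCov hgauss _)
    (isHermitian_combT (hf n) (hg n) _) h3

end Normality

/-! ### Measurable joint diagonalisation -/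

section Estimator

open Matrix

variable {p : ℕ}

lemma isClosed_forall {X : Type*} {ι : Sort*} [TopologicalSpace X] {r : ι → X → Prop}
    (h : ∀ i, IsClosed {x | r i x}) : IsClosed {x | ∀ i, r i x} := by
  rw [Set.ofPred_forall]
  exact isClosed_iInter h

/-- A joint diagonalisation that is a Borel function of the two matrices, with the signs of the rows
of `Γ` fixed by comparison with `B`. -/
lemma exists_measurable_isUnmixing (B : Matrix (Fin p) (Fin p) ℝ) :
    ∃ gam lam : Matrix (Fin p) (Fin p) ℝ → Matrix (Fin p) (Fin p) ℝ → Matrix (Fin p) (Fin p) ℝ,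
      MatMeasurable gam ∧ MatMeasurable lam ∧
      ∀ M₀ M, (∃ Γ Λ, IsUnmixing M₀ M Γ Λ) →
        IsUnmixing M₀ M (gam M₀ M) (lam M₀ M) ∧ ∀ i, 0 ≤ (gam M₀ M * B) i i := by
  let X := (Fin p → Fin p → ℝ) × (Fin p → Fin p → ℝ)
  obtain ⟨e⟩ : Nonempty (Fin p × Fin p ≃ Fin (p * p)) := ⟨finProdFinEquiv⟩
  obtain ⟨toM, toM_apply⟩ : ∃ toM : (Fin (p * p) → ℝ) → Matrix (Fin p) (Fin p) ℝ,
      ∀ y i j, toM y i j = y (e (i, j)) := ⟨fun y => Matrix.of fun i j => y (e (i, j)), by simp⟩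
  have htoM : Continuous toM := by
    refine continuous_matrix fun i j => ?_
    simp only [toM_apply]
    fun_prop
  have hof : Continuous fun v : Fin p → Fin p → ℝ => (Matrix.of v : Matrix (Fin p) (Fin p) ℝ) :=
    continuous_matrix fun i j => by simp only [Matrix.of_apply]; fun_prop
  let K : Set (X × (Fin (p * p) → ℝ)) :=
    {q | toM q.2 * Matrix.of q.1.1 * (toM q.2)ᵀ = 1} ∩
    ({q | ∀ i j, i ≠ j → (toM q.2 * Matrix.of q.1.2 * (toM q.2)ᵀ) i j = 0} ∩
    ({q | ∀ i j, i ≤ j → (toM q.2 * Matrix.of q.1.2 * (toM q.2)ᵀ) j j ≤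
      (toM q.2 * Matrix.of q.1.2 * (toM q.2)ᵀ) i i} ∩
    {q | ∀ i, 0 ≤ (toM q.2 * B) i i}))
  have c2 : Continuous fun q : X × (Fin (p * p) → ℝ) => toM q.2 := htoM.comp continuous_snd
  have c0 : Continuous fun q : X × (Fin (p * p) → ℝ) =>
      toM q.2 * Matrix.of q.1.1 * (toM q.2)ᵀ :=
    (c2.matrix_mul (hof.comp (continuous_fst.comp continuous_fst))).matrix_mul c2.matrix_transpose
  have c1 : Continuous fun q : X × (Fin (p * p) → ℝ) =>
      toM q.2 * Matrix.of q.1.2 * (toM q.2)ᵀ :=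
    (c2.matrix_mul (hof.comp (continuous_snd.comp continuous_fst))).matrix_mul c2.matrix_transpose
  have hK : IsClosed K := by
    refine (isClosed_eq c0 continuous_const).inter (IsClosed.inter ?_ (IsClosed.inter ?_ ?_))
    · exact isClosed_forall fun i => isClosed_forall fun j => isClosed_forall fun _ =>
        isClosed_eq (c1.matrix_elem i j) continuous_const
    · exact isClosed_forall fun i => isClosed_forall fun j => isClosed_forall fun _ =>
        isClosed_le (c1.matrix_elem j j) (c1.matrix_elem i i)
    · exact isClosed_forall fun i =>
        isClosed_le continuous_const ((c2.matrix_mul continuous_const).matrix_elem i i)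
  obtain ⟨sel, hsm, hs⟩ := exists_measurable_selection hK
  let gam : Matrix (Fin p) (Fin p) ℝ → Matrix (Fin p) (Fin p) ℝ → Matrix (Fin p) (Fin p) ℝ :=
    fun M₀ M => toM (sel (fun i j => M₀ i j, fun i j => M i j))
  refine ⟨gam, fun M₀ M => gam M₀ M * M * (gam M₀ M)ᵀ, ?_, ?_, ?_⟩
  · refine measurable_pi_iff.2 fun i => measurable_pi_iff.2 fun j => ?_
    have h1 : Measurable fun q : X => sel q (e (i, j)) := (measurable_pi_apply _).comp hsm
    simp only [gam, toM_apply]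
    exact h1
  · refine measurable_pi_iff.2 fun i => measurable_pi_iff.2 fun j => ?_
    have h1 := (c1.matrix_elem i j).measurable
    have h2 : Measurable fun q : X => (q, sel q) := measurable_id.prodMk hsm
    exact h1.comp h2
  · rintro M₀ M ⟨Γ, Λ, h⟩
    obtain ⟨Γ', h', hnn⟩ := h.exists_nonneg B
    let y : Fin (p * p) → ℝ := fun a => Γ' (e.symm a).1 (e.symm a).2
    have hy : toM y = Γ' := by ext i j; simp [toM_apply, y]
    have hmem : ((fun i j => M₀ i j, fun i j => M i j), y) ∈ K := by
      have m0 : toM y * M₀ * (toM y)ᵀ = 1 := by rw [hy, h'.whiten]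
      have m1 : toM y * M * (toM y)ᵀ = Λ := by rw [hy, h'.diagonalise]
      exact ⟨m0, fun i j hij => (congrFun (congrFun m1 i) j).trans (h'.isDiag hij),
        fun i j hij => (congrFun (congrFun m1 j) j).le.trans
          ((h'.decreasing i j hij).trans (congrFun (congrFun m1 i) i).ge),
        fun i => (hnn i).trans_eq (congrFun (congrFun (congrArg (· * B) hy.symm) i) i)⟩
    obtain ⟨k0, k1, k2, k3⟩ := hs _ ⟨y, hmem⟩
    exact ⟨⟨k0, rfl, fun i j hij => k1 i j hij, k2⟩, k3⟩

/-- A symmetric matrix that is entrywise close to the identity is positive definite. -/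
lemma posDef_of_abs_sub_one_le {N : Matrix (Fin p) (Fin p) ℝ} {δ : ℝ} (hN : Nᵀ = N)
    (h : ∀ i j, |N i j - (1 : Matrix (Fin p) (Fin p) ℝ) i j| ≤ δ) (hδ : p * δ < 1) :
    N.PosDef := by
  refine Matrix.PosDef.of_dotProduct_mulVec_pos ?_ fun x hx => ?_
  · rw [IsHermitian, conjTranspose_eq_transpose_of_trivial, hN]
  have h1 : x ⬝ᵥ N *ᵥ x = ∑ i, x i ^ 2 +
      ∑ i, ∑ j, (N i j - (1 : Matrix (Fin p) (Fin p) ℝ) i j) * (x i * x j) := by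
    have h2 : ∀ i j, x i * (N i j * x j) = (1 : Matrix (Fin p) (Fin p) ℝ) i j * (x i * x j) +
        (N i j - (1 : Matrix (Fin p) (Fin p) ℝ) i j) * (x i * x j) := by intros; ring
    simp only [dotProduct, mulVec, Finset.mul_sum, h2, Finset.sum_add_distrib, Matrix.one_apply,
      ite_mul, one_mul, zero_mul, Finset.sum_ite_eq, Finset.mem_univ, if_true, sq]
  have h3 : ∀ i j, -(δ * (x i ^ 2 + x j ^ 2) / 2) ≤
      (N i j - (1 : Matrix (Fin p) (Fin p) ℝ) i j) * (x i * x j) := by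
    intro i j
    have h4 : |x i * x j| ≤ (x i ^ 2 + x j ^ 2) / 2 := by
      rw [abs_le]
      constructor <;> nlinarith [sq_nonneg (x i - x j), sq_nonneg (x i + x j)]
    have h5 := abs_mul (N i j - (1 : Matrix (Fin p) (Fin p) ℝ) i j) (x i * x j)
    have h6 : |N i j - (1 : Matrix (Fin p) (Fin p) ℝ) i j| * |x i * x j| ≤
        δ * ((x i ^ 2 + x j ^ 2) / 2) :=
      mul_le_mul (h i j) h4 (abs_nonneg _) ((abs_nonneg _).trans (h i j))
    have h7 := neg_abs_le ((N i j - (1 : Matrix (Fin p) (Fin p) ℝ) i j) * (x i * x j))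
    linarith
  have h8 : ∑ i, ∑ j, -(δ * (x i ^ 2 + x j ^ 2) / 2) = -(p * δ * ∑ i, x i ^ 2) := by
    simp only [Finset.sum_neg_distrib, ← Finset.sum_div, ← Finset.mul_sum, Finset.sum_add_distrib,
      Finset.sum_const, Finset.card_univ, Fintype.card_fin, nsmul_eq_mul]
    ring
  have h9 := Finset.sum_le_sum fun i (_ : i ∈ Finset.univ) =>
    Finset.sum_le_sum fun j (_ : j ∈ Finset.univ) => h3 i j
  rw [h8] at h9
  have h10 : 0 < ∑ i, x i ^ 2 := by
    obtain ⟨i, hi⟩ := Function.ne_iff.1 hx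
    rw [Pi.zero_apply] at hi
    exact Finset.sum_pos' (fun i _ => sq_nonneg _) ⟨i, Finset.mem_univ i, by positivity⟩
  rw [star_trivial, h1]
  nlinarith

end Estimator

/-! ### The linearisation of the joint diagonalisation -/

section Linearisation

open Matrix

variable {p : ℕ}

/-- `G` is the matrix of the derivative `(T₀, T₁) ↦ (gamDeriv λ T₀ T₁, diag(T₁) - λ diag(T₀))` of
the joint diagonalisation, and `M̄` carries the derivative of `Γ Ω` to that of `Γ`. -/
lemma mBar_mul_gMat_mulVec (W : Matrix (Fin p) (Fin p) ℝ) (lam : Fin p → ℝ)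
    (T₀ T₁ : Matrix (Fin p) (Fin p) ℝ) :
    (mBar W * gMat lam) *ᵥ (Sum.elim (fun u => T₀ u.1 u.2) fun u => T₁ u.1 u.2) =
      Sum.elim (fun u => (gamDeriv lam T₀ T₁ * W) u.1 u.2) fun i => T₁ i i - lam i * T₀ i i := by
  have h1 : gA lam *ᵥ (fun u => T₀ u.1 u.2) + gB lam *ᵥ (fun u => T₁ u.1 u.2) =
      fun u => gamDeriv lam T₀ T₁ u.1 u.2 := by
    ext ⟨i, j⟩
    simp only [gA, gB, Pi.add_apply, mulVec_diagonal, gamDeriv, Matrix.of_apply]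
    split_ifs with hij
    · ring
    · rw [← neg_sub (lam i) (lam j), inv_neg]; ring
  have h2 : gC lam *ᵥ (fun u => T₀ u.1 u.2) + gD p *ᵥ (fun u => T₁ u.1 u.2) =
      fun i => T₁ i i - lam i * T₀ i i := by
    ext i
    simp only [gC, gD, Pi.add_apply, mulVec, dotProduct, Matrix.of_apply, ite_mul, one_mul,
      zero_mul, Finset.sum_ite_eq', Finset.mem_univ, if_true]
    ring
  rw [← Matrix.mulVec_mulVec, gMat, fromBlocks_mulVec, mBar, fromBlocks_mulVec]
  simp only [Sum.elim_comp_inl, Sum.elim_comp_inr, h1, h2, Matrix.zero_mulVec, add_zero, zero_add,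
    Matrix.one_mulVec]
  congr 1
  ext ⟨i, j⟩
  simp only [mMat, mulVec, dotProduct, Matrix.of_apply, Fintype.sum_prod_type, ite_mul, zero_mul,
    Matrix.mul_apply]
  rw [Finset.sum_eq_single i (fun k _ hk => by simp [hk.symm]) (by simp)]
  refine Finset.sum_congr rfl fun l _ => ?_
  rw [if_pos rfl, mul_comm]

lemma tendsto_mBar_mul_gMat {ι : Type*} {l : Filter ι} {lam : ι → Fin p → ℝ} {lam' : Fin p → ℝ}
    (W : Matrix (Fin p) (Fin p) ℝ) (hlam' : StrictAnti lam') (h : Tendsto lam l (𝓝 lam')) :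
    Tendsto (fun x => mBar W * gMat (lam x)) l (𝓝 (mBar W * gMat lam')) := by
  have hl : ∀ i, Tendsto (fun x => lam x i) l (𝓝 (lam' i)) := tendsto_pi_nhds.1 h
  have hinv : ∀ i j, i ≠ j →
      Tendsto (fun x => (lam x i - lam x j)⁻¹) l (𝓝 (lam' i - lam' j)⁻¹) := fun i j hij =>
    ((hl i).sub (hl j)).inv₀ (sub_ne_zero.2 (hlam'.injective.ne hij))
  have hA : ∀ a : Pos p, Tendsto (fun x => if a.1 = a.2 then -(1 / 2 : ℝ) else
      -(lam x a.1) * (lam x a.1 - lam x a.2)⁻¹) l (𝓝 (if a.1 = a.2 then -(1 / 2) else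
      -(lam' a.1) * (lam' a.1 - lam' a.2)⁻¹)) := by
    intro a
    split_ifs with ha
    · exact tendsto_const_nhds
    · exact (hl _).neg.mul (hinv _ _ ha)
  have hB : ∀ a : Pos p, Tendsto (fun x => if a.1 = a.2 then (0 : ℝ) else
      (lam x a.1 - lam x a.2)⁻¹) l (𝓝 (if a.1 = a.2 then 0 else (lam' a.1 - lam' a.2)⁻¹)) := by
    intro a
    split_ifs with ha
    · exact tendsto_const_nhds
    · exact hinv _ _ ha
  have hG : Tendsto (fun x => gMat (lam x)) l (𝓝 (gMat lam')) := by
    refine tendsto_pi_nhds.2 fun a => tendsto_pi_nhds.2 fun b => ?_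
    rcases a with a | a <;> rcases b with b | b
    · simp only [gMat, fromBlocks_apply₁₁, gA, diagonal_apply]
      by_cases hab : a = b
      · simp only [hab, if_true]; exact hA b
      · simp only [hab, if_false]; exact tendsto_const_nhds
    · simp only [gMat, fromBlocks_apply₁₂, gB, diagonal_apply]
      by_cases hab : a = b
      · simp only [hab, if_true]; exact hB b
      · simp only [hab, if_false]; exact tendsto_const_nhds
    · simp only [gMat, fromBlocks_apply₂₁, gC, Matrix.of_apply]
      split_ifs
      · exact (hl a).neg
      · exact tendsto_const_nhds
    · simp only [gMat, fromBlocks_apply₂₂]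
      exact tendsto_const_nhds
  exact ((continuous_const.matrix_mul continuous_id).tendsto _).comp hG

end Linearisation

/-! ### Transfer of weak convergence along a uniform linearisation -/

section Transfer

variable {Ω : Type*} [MeasurableSpace Ω] {P : Measure Ω} [IsProbabilityMeasure P]
  {E : Type*} [NormedAddCommGroup E] [InnerProductSpace ℝ E] [FiniteDimensional ℝ E]
  [MeasurableSpace E] [BorelSpace E]
  {F : Type*} [NormedAddCommGroup F] [InnerProductSpace ℝ F] [FiniteDimensional ℝ F]
  [MeasurableSpace F] [BorelSpace F]
  {e : ℕ → Ω → E} {μ : Measure E} [IsProbabilityMeasure μ]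

/-- Convergence of the characteristic functions to a continuous limit implies tightness. -/
lemma exists_measure_norm_gt_le (he : ∀ m, AEMeasurable (e m) P)
    (h : ∀ a, Tendsto (fun m => charFun (P.map (e m)) a) atTop (𝓝 (charFun μ a)))
    {δ : ENNReal} (hδ : 0 < δ) : ∃ R : ℝ, ∀ m, P {ω | R < ‖e m ω‖} ≤ δ := by
  have : ∀ m, IsProbabilityMeasure (P.map (e m)) := fun m => Measure.isProbabilityMeasure_map (he m)
  have ht := isTightMeasureSet_of_tendsto_charFun (μ := fun m => P.map (e m))
    (by fun_prop : ContinuousAt (charFun μ) 0) h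
  obtain ⟨K, hK, hK'⟩ := isTightMeasureSet_iff_exists_isCompact_measure_compl_le.1 ht δ hδ
  obtain ⟨R, hR⟩ := hK.isBounded.exists_norm_le
  refine ⟨R, fun m => ?_⟩
  have h1 := hK' _ ⟨m, rfl⟩
  rw [Measure.map_apply_of_aemeasurable (he m) hK.measurableSet.compl] at h1
  refine (measure_mono ?_).trans h1
  intro ω hω hmem
  exact absurd (hR _ hmem) (not_le.2 hω)

/-- Events that eventually contain every event on which the errors are bounded have probability
tending to one, by tightness of the errors. -/
lemma tendsto_measure_one (he : ∀ m, AEMeasurable (e m) P)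
    (h : ∀ a, Tendsto (fun m => charFun (P.map (e m)) a) atTop (𝓝 (charFun μ a)))
    {S : ℕ → Set Ω} (hS : ∀ R : ℝ, ∀ᶠ m in atTop, ∀ ω, ‖e m ω‖ ≤ R → ω ∈ S m) :
    Tendsto (fun m => P (S m)) atTop (𝓝 1) := by
  refine ENNReal.tendsto_nhds ENNReal.one_ne_top |>.2 fun δ hδ => ?_
  obtain ⟨R, hR⟩ := exists_measure_norm_gt_le he h hδ
  filter_upwards [hS R] with m hm
  refine ⟨?_, prob_le_one.trans (by simp)⟩
  have h1 : P Set.univ ≤ P (S m) + P {ω | R < ‖e m ω‖} := by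
    refine (measure_mono ?_).trans (measure_union_le _ _)
    intro ω _
    rcases le_or_gt ‖e m ω‖ R with h2 | h2
    · exact Or.inl (hm ω h2)
    · exact Or.inr h2
  rw [measure_univ] at h1
  exact tsub_le_iff_right.2 (h1.trans (by gcongr; exact hR m))

/-- The delta method with a linearisation that is uniform on bounded sets. -/
lemma tendsto_law_of_linearisation (he : ∀ m, AEMeasurable (e m) P)
    (h : ∀ a, Tendsto (fun m => charFun (P.map (e m)) a) atTop (𝓝 (charFun μ a)))
    {Y : ℕ → Ω → F} (hY : ∀ m, AEMeasurable (Y m) P) (L : E →L[ℝ] F)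
    (hL : ∀ R η : ℝ, 0 < η → ∀ᶠ m in atTop, ∀ ω, ‖e m ω‖ ≤ R → ‖Y m ω - L (e m ω)‖ ≤ η) :
    Tendsto (β := ProbabilityMeasure F)
      (fun m => ⟨P.map (Y m), Measure.isProbabilityMeasure_map (hY m)⟩) atTop
      (𝓝 ⟨μ.map L, Measure.isProbabilityMeasure_map (by fun_prop)⟩) := by
  have h1 : TendstoInDistribution e atTop id (fun _ => P) μ := by
    refine ⟨he, aemeasurable_id, ?_⟩
    refine ProbabilityMeasure.tendsto_iff_tendsto_charFun.2 fun a => ?_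
    have h4 := h a
    rw [← Measure.map_id (μ := μ)] at h4
    exact h4
  have h2 := h1.continuous_comp L.continuous
  have h3 : TendstoInMeasure P (Y - fun m => L ∘ e m) atTop 0 := by
    refine tendstoInMeasure_of_ne_top fun ε hε hε' => ?_
    refine ENNReal.tendsto_nhds_zero.2 fun δ hδ => ?_
    obtain ⟨R, hR⟩ := exists_measure_norm_gt_le he h hδ
    have hε0 : 0 < ε.toReal := ENNReal.toReal_pos hε.ne' hε'
    filter_upwards [hL R (ε.toReal / 2) (by linarith)] with m hm
    refine (measure_mono ?_).trans (hR m)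
    intro ω hω
    by_contra hc
    have h4 := hm ω (not_lt.1 hc)
    have h5 : ε ≤ edist (Y m ω - L (e m ω)) 0 := hω
    rw [edist_dist, dist_zero_right, ← ENNReal.ofReal_toReal hε',
      ENNReal.ofReal_le_ofReal_iff (norm_nonneg _)] at h5
    linarith
  have h6 := (tendstoInDistribution_of_tendstoInMeasure_sub Y (L ∘ id) h2 h3 hY).tendsto
  exact h6

end Transfer

/-! ### Uniform bounds and the linearisation of the estimators -/

section Bounds

open Matrix

variable {Ω : Type*} [MeasurableSpace Ω] {P : Measure Ω} {d p n : ℕ}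
  {Z : Fin p → Loc d → Ω → ℝ} {s : Fin n → Loc d} {f : Loc d → ℝ}

lemma abs_kernelZero_le {r : ℝ} (hr : 0 < r) (x : Loc d) :
    |kernelZero d x| ≤ 1 / (1 + ‖x‖ ^ r) := by
  by_cases hx : x = 0
  · subst hx
    simp [kernelZero, Real.zero_rpow hr.ne']
  · rw [kernelZero, Set.indicator_of_notMem (by simpa using hx), abs_zero]
    positivity

lemma kernelZero_neg (x : Loc d) : kernelZero d (-x) = kernelZero d x := by
  by_cases hx : x = 0
  · simp [hx]
  · rw [kernelZero, Set.indicator_of_notMem (by simpa using hx),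
      Set.indicator_of_notMem (by simpa using hx)]

lemma kernelZero_sub_comm (x y : Loc d) : kernelZero d (x - y) = kernelZero d (y - x) := by
  rw [← kernelZero_neg, neg_sub]

attribute [local instance] Matrix.linftyOpNormedRing Matrix.linftyOpNormedAlgebra

lemma norm_latentCov_le {K : Fin p → Loc d → ℝ} {A B r : ℝ} (hA : 0 ≤ A)
    (hcov : ∀ k l x y, cov[Z k x, Z l y; P] = if k = l then K k (x - y) else 0)
    (hK : ∀ k x, |K k x| ≤ A / (1 + ‖x‖ ^ r))
    (hs : ∀ i, ∑ j, (1 + ‖s i - s j‖ ^ r)⁻¹ ≤ B) (hB : 0 ≤ B) : ‖latentCov P s Z‖ ≤ A * B := by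
  refine linfty_opNorm_le (by positivity) fun x => ?_
  rw [Fintype.sum_prod_type]
  have h1 : ∀ j, ∑ m, |latentCov P s Z x (j, m)| ≤ A * (1 + ‖s x.1 - s j‖ ^ r)⁻¹ := by
    intro j
    rw [Finset.sum_eq_single x.2 (fun m _ hm => by
      simp [latentCov, hcov, hm.symm]) (by simp)]
    simp only [latentCov, Matrix.of_apply, hcov, if_true]
    exact (hK _ _).trans_eq (div_eq_mul_inv _ _)
  refine (Finset.sum_le_sum fun j _ => h1 j).trans ?_
  rw [← Finset.mul_sum]
  gcongr
  exact hs x.1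

lemma norm_pairT_le {A B r : ℝ} (hA : 0 ≤ A) (hr : 0 < r) (hf : ∀ x, |f x| ≤ A / (1 + ‖x‖ ^ r))
    (hs : ∀ i, ∑ j, (1 + ‖s i - s j‖ ^ r)⁻¹ ≤ B) (hB : 0 ≤ B) (c : Pos p ⊕ Pos p) :
    ‖pairT s (kernelZero d) f c‖ ≤ (1 + A) * B := by
  rcases c with c | c
  · refine (norm_blockT_le zero_le_one (abs_kernelZero_le hr) hs hB c.1 c.2).trans ?_
    gcongr; linarith
  · refine (norm_blockT_le hA hf hs hB c.1 c.2).trans ?_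
    gcongr; linarith

lemma abs_latentLam_le (hcov0 : ∀ k l x y, k ≠ l → cov[Z k x, Z l y; P] = 0)
    (hf : ∀ i j, f (s i - s j) = f (s j - s i)) {B C : ℝ} (hB : ‖latentCov P s Z‖ ≤ B)
    (hC : ∀ c : Pos p ⊕ Pos p, ‖pairT s (kernelZero d) f c‖ ≤ C) (k : Fin p) :
    |latentLam P s f Z k| ≤ p * (B * C) := by
  have h1 := trace_latentCov_mul_blockT hcov0 hf k k
  rw [diagonal_apply_eq] at h1
  rw [← h1]
  refine (abs_inv_mul_trace_le _).trans ?_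
  gcongr
  refine (norm_mul_le _ _).trans ?_
  have := (norm_nonneg _).trans hB
  gcongr
  exact hC (Sum.inr (k, k))

end Bounds

section Estimation

open Matrix

variable {Ω : Type*} [MeasurableSpace Ω] {P : Measure Ω} {d p : ℕ}
  {Z : Fin p → Loc d → Ω → ℝ} {f : Loc d → ℝ} {Om : Matrix (Fin p) (Fin p) ℝ}

lemma latentEmp_eq_add {n : ℕ} {s : Fin n → Loc d} (hn : 1 ≤ n) (ω : Ω) :
    latentEmp s (kernelZero d) Z ω = diagonal (latentLam P s (kernelZero d) Z) + (√(n : ℝ))⁻¹ •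
      Matrix.of fun i j => errVec P s (kernelZero d) f Z ω (Sum.inl (i, j)) := by
  have hn0 : √(n : ℝ) ≠ 0 := (Real.sqrt_pos.2 (by exact_mod_cast hn)).ne'
  ext i j
  simp [errVec, hn0]

lemma latentEmp_eq_add' {n : ℕ} {s : Fin n → Loc d} (hn : 1 ≤ n) (ω : Ω) :
    latentEmp s f Z ω = diagonal (latentLam P s f Z) + (√(n : ℝ))⁻¹ •
      Matrix.of fun i j => errVec P s (kernelZero d) f Z ω (Sum.inr (i, j)) := by
  have hn0 : √(n : ℝ) ≠ 0 := (Real.sqrt_pos.2 (by exact_mod_cast hn)).ne'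
  ext i j
  simp [errVec, hn0]

lemma inv_mul_mul_inv_transpose (hOm : IsUnit Om.det) (N : Matrix (Fin p) (Fin p) ℝ) :
    Om⁻¹ * (Om * N * Omᵀ) * (Om⁻¹)ᵀ = N := by
  calc _ = (Om⁻¹ * Om) * N * (Om⁻¹ * Om)ᵀ := by
        rw [transpose_mul]; simp only [Matrix.mul_assoc]
    _ = N := by rw [Matrix.nonsing_inv_mul Om hOm]; simp

/-- When the normalised errors are bounded, the first empirical matrix is positive definite
for large `n`, so that a joint diagonalisation exists. -/
lemma eventually_exists_isUnmixing {s : (n : ℕ) → Fin n → Loc d} (hOm : IsUnit Om.det)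
    (hf : ∀ n (i j : Fin n), f (s n i - s n j) = f (s n j - s n i))
    (hlam0 : ∀ n, 1 ≤ n → latentLam P (s n) (kernelZero d) Z = fun _ => 1) (R : ℝ) :
    ∀ᶠ n in atTop, ∀ ω, ‖errVec P (s n) (kernelZero d) f Z ω‖ ≤ R →
      ∃ Γ Λ, IsUnmixing (empCov (s n) (kernelZero d) (mix Om Z) ω)
        (empCov (s n) f (mix Om Z) ω) Γ Λ := by
  have h1 : Tendsto (fun n : ℕ => p * ((√(n : ℝ))⁻¹ * R)) atTop (𝓝 0) := by
    have h2 : Tendsto (fun n : ℕ => (√(n : ℝ))⁻¹) atTop (𝓝 0) :=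
      tendsto_inv_atTop_zero.comp (Real.tendsto_sqrt_atTop.comp tendsto_natCast_atTop_atTop)
    simpa using (h2.mul_const R).const_mul (p : ℝ)
  filter_upwards [h1.eventually_lt_const zero_lt_one, eventually_ge_atTop 1] with n hn hn1 ω hω
  have hpd : (latentEmp (s n) (kernelZero d) Z ω).PosDef := by
    refine posDef_of_abs_sub_one_le (transpose_latentEmp
      (fun i j => kernelZero_sub_comm _ _) ω) (fun i j => ?_) hn
    rw [latentEmp_eq_add (P := P) (f := f) hn1, hlam0 n hn1, diagonal_one, Matrix.add_apply,
      add_sub_cancel_left, Matrix.smul_apply, smul_eq_mul, abs_mul, abs_of_nonneg (by positivity)]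
    gcongr
    exact (PiLp.norm_apply_le (errVec P (s n) (kernelZero d) f Z ω) (Sum.inl (i, j))).trans hω
  obtain ⟨Γ, Λ, h⟩ := exists_isUnmixing hpd (transpose_latentEmp (Z := Z) (hf n) ω)
  have h2 := h.congr_basis (Matrix.nonsing_inv_mul Om hOm)
  rw [← empCov_mix, ← empCov_mix] at h2
  exact ⟨_, _, h2⟩

/-- The estimation error is, uniformly over bounded normalised errors, close to its linearisation at
the limit of the population eigenvalues. Uniformity is expressed by a filter on pairs `(m, ω)`;
along an ultrafilter the bounded normalised errors converge. -/
lemma eventually_norm_scaledVecDiag_sub_le {s : (n : ℕ) → Fin n → Loc d} (hOm : IsUnit Om.det)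
    (hf : ∀ n (i j : Fin n), f (s n i - s n j) = f (s n j - s n i))
    (hlam0 : ∀ n, 1 ≤ n → latentLam P (s n) (kernelZero d) Z = fun _ => 1)
    {gam lam : Matrix (Fin p) (Fin p) ℝ → Matrix (Fin p) (Fin p) ℝ → Matrix (Fin p) (Fin p) ℝ}
    (hsel : ∀ M₀ M, (∃ Γ Λ, IsUnmixing M₀ M Γ Λ) →
      IsUnmixing M₀ M (gam M₀ M) (lam M₀ M) ∧ ∀ i, 0 ≤ (gam M₀ M * Om) i i)
    {Lam : ℕ → Matrix (Fin p) (Fin p) ℝ}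
    (hLam : ∀ᶠ n in atTop, Lam n = diagonal (latentLam P (s n) f Z))
    {ν : ℕ → ℕ} (hν : Tendsto ν atTop atTop) {lam' : Fin p → ℝ} (hlam' : StrictAnti lam')
    (hlim : Tendsto (fun m => latentLam P (s (ν m)) f Z) atTop (𝓝 lam'))
    {R η : ℝ} (hη : 0 < η) :
    ∀ᶠ m in atTop, ∀ ω, ‖errVec P (s (ν m)) (kernelZero d) f Z ω‖ ≤ R →
      ‖scaledVecDiag (ν m)
          (gam (empCov (s (ν m)) (kernelZero d) (mix Om Z) ω) (empCov (s (ν m)) f (mix Om Z) ω) -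
            Om⁻¹)
          (lam (empCov (s (ν m)) (kernelZero d) (mix Om Z) ω) (empCov (s (ν m)) f (mix Om Z) ω) -
            Lam (ν m)) -
        WithLp.toLp 2 ((mBar Om⁻¹ * gMat lam') *ᵥ
          (errVec P (s (ν m)) (kernelZero d) f Z ω).ofLp)‖ ≤ η := by
  set e : ℕ × Ω → EuclideanSpace ℝ (Pos p ⊕ Pos p) :=
    fun x => errVec P (s (ν x.1)) (kernelZero d) f Z x.2 with he
  set M₀ : ℕ × Ω → Matrix (Fin p) (Fin p) ℝ :=
    fun x => empCov (s (ν x.1)) (kernelZero d) (mix Om Z) x.2 with hM₀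
  set M₁ : ℕ × Ω → Matrix (Fin p) (Fin p) ℝ :=
    fun x => empCov (s (ν x.1)) f (mix Om Z) x.2 with hM₁
  let Y : ℕ × Ω → VecDiag p := fun x => scaledVecDiag (ν x.1)
    (gam (M₀ x) (M₁ x) - Om⁻¹) (lam (M₀ x) (M₁ x) - Lam (ν x.1))
  let l : Filter (ℕ × Ω) := comap Prod.fst atTop ⊓ 𝓟 {x | ‖e x‖ ≤ R}
  have hfst : Tendsto (Prod.fst : ℕ × Ω → ℕ) l atTop := tendsto_comap.mono_left inf_le_left
  have key : Tendsto (fun x => Y x - WithLp.toLp 2 ((mBar Om⁻¹ * gMat lam') *ᵥ (e x).ofLp)) l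
      (𝓝 0) := by
    rw [tendsto_iff_ultrafilter]
    intro u hu
    have hufst : Tendsto (Prod.fst : ℕ × Ω → ℕ) u atTop := hfst.mono_left hu
    have hR : ∀ᶠ x in (u : Filter (ℕ × Ω)), ‖e x‖ ≤ R :=
      (hu.trans inf_le_right) (mem_principal_self _)
    obtain ⟨e', -, he'⟩ := (isCompact_closedBall (0 : EuclideanSpace ℝ (Pos p ⊕ Pos p))
      R).ultrafilter_le_nhds (u.map e) (le_principal_iff.2 (hR.mono fun x hx => by simpa using hx))
    have he' : Tendsto e u (𝓝 e') := he'
    have hec : ∀ c, Tendsto (fun x => e x c) u (𝓝 (e' c)) := fun c =>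
      ((EuclideanSpace.proj (𝕜 := ℝ) c).continuous.tendsto e').comp he'
    have hνu : Tendsto (fun x : ℕ × Ω => ν x.1) u atTop := hν.comp hufst
    have hr : Tendsto (fun x : ℕ × Ω => (√(ν x.1 : ℝ))⁻¹) u (𝓝 0) :=
      tendsto_inv_atTop_zero.comp
        (Real.tendsto_sqrt_atTop.comp (tendsto_natCast_atTop_atTop.comp hνu))
    have hν1 := hνu.eventually (eventually_ge_atTop 1)
    have hr0 : ∀ᶠ x in (u : Filter (ℕ × Ω)), (√(ν x.1 : ℝ))⁻¹ ≠ 0 :=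
      hν1.mono fun x hx => (inv_pos.2 (Real.sqrt_pos.2 (by exact_mod_cast hx))).ne'
    have hun : ∀ᶠ x in (u : Filter (ℕ × Ω)), ∃ Γ Λ, IsUnmixing (M₀ x) (M₁ x) Γ Λ := by
      filter_upwards [hνu.eventually (eventually_exists_isUnmixing hOm hf hlam0 R), hR] with x h1 h2
      exact h1 _ h2
    have hT₀ : Tendsto (fun x => (Matrix.of fun i j => e x (Sum.inl (i, j)) :
        Matrix (Fin p) (Fin p) ℝ)) u (𝓝 (Matrix.of fun i j => e' (Sum.inl (i, j)))) :=
      tendsto_pi_nhds.2 fun i => tendsto_pi_nhds.2 fun j => hec _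
    have hT₁ : Tendsto (fun x => (Matrix.of fun i j => e x (Sum.inr (i, j)) :
        Matrix (Fin p) (Fin p) ℝ)) u (𝓝 (Matrix.of fun i j => e' (Sum.inr (i, j)))) :=
      tendsto_pi_nhds.2 fun i => tendsto_pi_nhds.2 fun j => hec _
    have hG : ∀ᶠ x in (u : Filter (ℕ × Ω)), IsUnmixing
        (1 + (√(ν x.1 : ℝ))⁻¹ • Matrix.of fun i j => e x (Sum.inl (i, j)))
        (diagonal (latentLam P (s (ν x.1)) f Z) +
          (√(ν x.1 : ℝ))⁻¹ • Matrix.of fun i j => e x (Sum.inr (i, j)))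
        (gam (M₀ x) (M₁ x) * Om) (lam (M₀ x) (M₁ x)) := by
      filter_upwards [hun, hν1] with x hx hx1
      have h1 := (hsel _ _ hx).1.congr_basis (Matrix.mul_nonsing_inv Om hOm)
      have e0 : Om⁻¹ * M₀ x * (Om⁻¹)ᵀ =
          1 + (√(ν x.1 : ℝ))⁻¹ • Matrix.of fun i j => e x (Sum.inl (i, j)) := by
        have := latentEmp_eq_add (P := P) (s := s (ν x.1)) (Z := Z) (f := f) hx1 x.2
        rw [hlam0 _ hx1, diagonal_one] at this
        simp only [hM₀, empCov_mix, inv_mul_mul_inv_transpose hOm]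
        exact this
      have e1 : Om⁻¹ * M₁ x * (Om⁻¹)ᵀ = diagonal (latentLam P (s (ν x.1)) f Z) +
          (√(ν x.1 : ℝ))⁻¹ • Matrix.of fun i j => e x (Sum.inr (i, j)) := by
        simp only [hM₁, empCov_mix, inv_mul_mul_inv_transpose hOm]
        exact latentEmp_eq_add' hx1 x.2
      rwa [e0, e1] at h1
    have hG0 : ∀ᶠ x in (u : Filter (ℕ × Ω)), ∀ i, 0 ≤ (gam (M₀ x) (M₁ x) * Om) i i :=
      hun.mono fun x hx => (hsel _ _ hx).2
    obtain ⟨h3, h4⟩ := tendsto_deriv_of_isUnmixing hlam' (hlim.comp hufst) hr hr0 hT₀ hT₁ hG hG0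
    have hvec : (mBar Om⁻¹ * gMat lam') *ᵥ e'.ofLp = Sum.elim
        (fun a => (gamDeriv lam' (Matrix.of fun i j => e' (Sum.inl (i, j)))
          (Matrix.of fun i j => e' (Sum.inr (i, j))) * Om⁻¹) a.1 a.2)
        fun i => e' (Sum.inr (i, i)) - lam' i * e' (Sum.inl (i, i)) := by
      have h5 := mBar_mul_gMat_mulVec Om⁻¹ lam' (Matrix.of fun i j => e' (Sum.inl (i, j)))
        (Matrix.of fun i j => e' (Sum.inr (i, j)))
      refine Eq.trans (congrArg _ ?_) h5
      ext c
      rcases c with c | c <;> rfl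
    have h6 : Tendsto (fun x => WithLp.toLp 2 ((mBar Om⁻¹ * gMat lam') *ᵥ (e x).ofLp)) u
        (𝓝 (WithLp.toLp 2 ((mBar Om⁻¹ * gMat lam') *ᵥ e'.ofLp))) := by
      refine ((PiLp.continuous_toLp 2 _).tendsto _).comp ?_
      exact ((continuous_const.matrix_mulVec (PiLp.continuous_ofLp 2 _)).tendsto e').comp he'
    have h7 : Tendsto Y u (𝓝 (WithLp.toLp 2 ((mBar Om⁻¹ * gMat lam') *ᵥ e'.ofLp))) := by
      refine ((PiLp.continuous_toLp 2 _).tendsto _).comp (tendsto_pi_nhds.2 fun c => ?_)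
      rw [hvec]
      rcases c with ⟨i, j⟩ | i
      · have h8 := tendsto_pi_nhds.1 (tendsto_pi_nhds.1
          (((continuous_id.matrix_mul (continuous_const (y := Om⁻¹))).tendsto _).comp h3) i) j
        refine h8.congr fun x => ?_
        simp only [Function.comp_apply, id, inv_inv, Matrix.smul_mul, Matrix.sub_mul,
          Matrix.one_mul, Matrix.smul_apply, smul_eq_mul, Sum.elim_inl]
        rw [Matrix.mul_assoc, Matrix.mul_nonsing_inv Om hOm, Matrix.mul_one]
      · refine (h4 i).congr' ?_
        filter_upwards [hνu.eventually hLam] with x hx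
        simp only [inv_inv, Sum.elim_inr, Function.comp_apply, Matrix.sub_apply]
        rw [hx, diagonal_apply_eq]
    simpa using h7.sub h6
  have h9 := key.norm.eventually_le_const (by simpa using hη)
  rw [eventually_inf_principal, eventually_comap] at h9
  filter_upwards [h9] with m hm ω hω
  exact hm (m, ω) rfl hω

end Estimation

/-! ### Convergence along subsequences -/

section Subsequences

open Matrix

lemma tendsto_dist_of_tendsto {X : Type*} [t : TopologicalSpace X] (dw : MetricSpace X)
    (h : dw.toPseudoMetricSpace.toUniformSpace.toTopologicalSpace = t) {u v : ℕ → X} {x : X}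
    (hu : Tendsto u atTop (𝓝 x)) (hv : Tendsto v atTop (𝓝 x)) :
    Tendsto (fun n => dw.dist (u n) (v n)) atTop (𝓝 0) := by
  subst h
  have h1 := hu.dist hv
  rwa [dist_self] at h1

lemma strictAnti_of_gap {p : ℕ} {lam : Fin p → ℝ} {ε : ℝ} (hε : 0 < ε)
    (h : ∀ i j : Fin p, (i : ℕ) + 1 = j → ε ≤ lam i - lam j) : StrictAnti lam := by
  cases p with
  | zero => exact fun i => i.elim0
  | succ p =>
    refine Fin.strictAnti_iff_succ_lt.2 fun i => ?_
    have := h i.castSucc i.succ (by simp)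
    linarith

lemma exists_eventually_gap {p : ℕ} {lam : ℕ → Fin p → ℝ}
    (h : 0 < liminf (fun n : ℕ => ⨅ (i : Fin p) (j : Fin p) (_ : (i : ℕ) + 1 = (j : ℕ)),
      ((lam n i - lam n j : ℝ) : EReal)) atTop) :
    ∃ ε : ℝ, 0 < ε ∧ ∀ᶠ n in atTop, ∀ i j : Fin p, (i : ℕ) + 1 = j → ε ≤ lam n i - lam n j := by
  obtain ⟨ε, h0, h1⟩ := EReal.lt_iff_exists_real_btwn.1 h
  refine ⟨ε, by exact_mod_cast h0, ?_⟩
  filter_upwards [eventually_lt_of_lt_liminf h1] with n hn i j hij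
  have h2 := hn.le.trans (iInf_le_of_le i (iInf_le_of_le j (iInf_le_of_le hij le_rfl)))
  exact_mod_cast h2

/-- Population eigenvalues with separated consecutive values and bounded positive semidefinite
matrices converge jointly along a further subsequence, and the limits keep these properties. -/
lemma exists_subseq_tendsto {p : ℕ} {ι : Type*} [Fintype ι] {lam : ℕ → Fin p → ℝ} {ε B C : ℝ}
    (hε : 0 < ε)
    (hgap : ∀ᶠ n in atTop, ∀ i j : Fin p, (i : ℕ) + 1 = j → ε ≤ lam n i - lam n j)
    (hlam : ∀ n k, |lam n k| ≤ B) {V : ℕ → Matrix ι ι ℝ} (hV : ∀ n c c', |V n c c'| ≤ C)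
    (hpsd : ∀ n, (V n).PosSemidef) {ns : ℕ → ℕ} (hns : Tendsto ns atTop atTop) :
    ∃ φ : ℕ → ℕ, StrictMono φ ∧ ∃ lam' V', StrictAnti lam' ∧ V'.PosSemidef ∧
      Tendsto (fun m => lam (ns (φ m))) atTop (𝓝 lam') ∧
      Tendsto (fun m => V (ns (φ m))) atTop (𝓝 V') := by
  let x : ℕ → (Fin p → ℝ) × (ι → ι → ℝ) := fun m => (lam (ns m), V (ns m))
  have hx : ∀ m, x m ∈ Metric.closedBall 0 (max |B| |C|) := by
    intro m
    rw [mem_closedBall_zero_iff, Prod.norm_def]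
    refine max_le ((pi_norm_le_iff_of_nonneg (by positivity)).2 fun k => ?_)
      ((pi_norm_le_iff_of_nonneg (by positivity)).2 fun c =>
        (pi_norm_le_iff_of_nonneg (by positivity)).2 fun c' => ?_)
    · exact (hlam _ _).trans ((le_abs_self _).trans (le_max_left _ _))
    · exact (hV _ _ _).trans ((le_abs_self _).trans (le_max_right _ _))
  obtain ⟨⟨lam', V'⟩, -, φ, hφ, h⟩ := tendsto_subseq_of_bounded Metric.isBounded_closedBall hx
  have h1 : Tendsto (fun m => lam (ns (φ m))) atTop (𝓝 lam') := (continuous_fst.tendsto _).comp h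
  have h2 : Tendsto (fun m => V (ns (φ m))) atTop (𝓝 (Matrix.of V')) :=
    (continuous_snd.tendsto _).comp h
  have hc : ∀ c c', Tendsto (fun m => V (ns (φ m)) c c') atTop (𝓝 (V' c c')) := fun c c' =>
    tendsto_pi_nhds.1 (tendsto_pi_nhds.1 h2 c) c'
  refine ⟨φ, hφ, lam', Matrix.of V', ?_, ?_, h1, h2⟩
  · refine strictAnti_of_gap hε fun i j hij => ?_
    refine ge_of_tendsto ((tendsto_pi_nhds.1 h1 i).sub (tendsto_pi_nhds.1 h1 j)) ?_
    filter_upwards [(hns.comp hφ.tendsto_atTop).eventually hgap] with m hm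
    exact hm i j hij
  · refine Matrix.PosSemidef.of_dotProduct_mulVec_nonneg ?_ fun a => ?_
    · ext c c'
      refine tendsto_nhds_unique ((hc c' c).congr fun m => ?_) (hc c c')
      exact congrFun (congrFun (hpsd (ns (φ m))).isHermitian c) c'
    · have h5 : Tendsto (fun m => star a ⬝ᵥ V (ns (φ m)) *ᵥ a) atTop
          (𝓝 (star a ⬝ᵥ Matrix.of V' *ᵥ a)) :=
        (((continuous_const (y := star a)).dotProduct (continuous_id.matrix_mulVec
          (continuous_const (y := a)))).tendsto (Matrix.of V')).comp h2
      exact ge_of_tendsto' h5 fun m => (hpsd _).dotProduct_mulVec_nonneg a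

end Subsequences

section NormalLaws

open Matrix

lemma inner_toEuclideanLin {ι κ : Type*} [Fintype ι] [Fintype κ] [DecidableEq κ]
    (H : Matrix ι κ ℝ) (x : EuclideanSpace ℝ κ) (a : EuclideanSpace ℝ ι) :
    inner ℝ (Matrix.toEuclideanLin H x) a = inner ℝ x (WithLp.toLp 2 (Hᵀ *ᵥ a.ofLp)) := by
  rw [EuclideanSpace.inner_eq_star_dotProduct, EuclideanSpace.inner_eq_star_dotProduct,
    star_trivial, star_trivial, Matrix.mulVec_transpose, ← Matrix.dotProduct_mulVec]
  rfl

lemma charFun_map_toEuclideanLin {ι κ : Type*} [Fintype ι] [Fintype κ] [DecidableEq κ]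
    (H : Matrix ι κ ℝ) (μ : Measure (EuclideanSpace ℝ κ)) (a : EuclideanSpace ℝ ι) :
    charFun (μ.map (LinearMap.toContinuousLinearMap (Matrix.toEuclideanLin H))) a =
      charFun μ (WithLp.toLp 2 (Hᵀ *ᵥ a.ofLp)) := by
  rw [charFun_apply, charFun_apply, integral_map (by fun_prop) (by fun_prop)]
  simp only [LinearMap.coe_toContinuousLinearMap', inner_toEuclideanLin]

lemma dotProduct_mul_mul_transpose {ι κ : Type*} [Fintype ι] [Fintype κ]
    (H : Matrix ι κ ℝ) (V : Matrix κ κ ℝ) (a : ι → ℝ) :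
    a ⬝ᵥ (H * V * Hᵀ) *ᵥ a = (Hᵀ *ᵥ a) ⬝ᵥ V *ᵥ (Hᵀ *ᵥ a) := by
  rw [← Matrix.mulVec_mulVec, ← Matrix.mulVec_mulVec, Matrix.dotProduct_mulVec,
    Matrix.mulVec_transpose]

lemma charFun_multivariateGaussian_mul_mul_transpose {ι κ : Type*} [Fintype ι] [DecidableEq ι]
    [Fintype κ] {V : Matrix κ κ ℝ} (hV : V.PosSemidef) (H : Matrix ι κ ℝ)
    (a : EuclideanSpace ℝ ι) :
    charFun (multivariateGaussian 0 (H * V * Hᵀ)) a =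
      Complex.exp (-((Hᵀ *ᵥ a.ofLp) ⬝ᵥ V *ᵥ (Hᵀ *ᵥ a.ofLp) / 2 : ℝ)) := by
  have hp : (H * V * Hᵀ).PosSemidef := by simpa using hV.mul_mul_conjTranspose_same H
  rw [charFun_multivariateGaussian hp, dotProduct_mul_mul_transpose, inner_zero_right]
  congr 1
  push_cast
  ring

lemma charFun_map_multivariateGaussian {ι κ : Type*} [Fintype ι] [Fintype κ] [DecidableEq κ]
    {V : Matrix κ κ ℝ} (hV : V.PosSemidef) (H : Matrix ι κ ℝ) (a : EuclideanSpace ℝ ι) :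
    charFun ((multivariateGaussian 0 V).map
        (LinearMap.toContinuousLinearMap (Matrix.toEuclideanLin H))) a =
      Complex.exp (-((Hᵀ *ᵥ a.ofLp) ⬝ᵥ V *ᵥ (Hᵀ *ᵥ a.ofLp) / 2 : ℝ)) := by
  rw [charFun_map_toEuclideanLin, charFun_multivariateGaussian hV, inner_zero_right]
  congr 1
  push_cast
  ring

lemma continuous_exp_quadratic {ι κ : Type*} [Fintype ι] [Fintype κ] (a : ι → ℝ) :
    Continuous fun q : Matrix ι κ ℝ × Matrix κ κ ℝ =>
      Complex.exp (-((q.1ᵀ *ᵥ a) ⬝ᵥ q.2 *ᵥ (q.1ᵀ *ᵥ a) / 2 : ℝ)) := by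
  have h5 : Continuous fun q : Matrix ι κ ℝ × Matrix κ κ ℝ => q.1ᵀ *ᵥ a :=
    continuous_fst.matrix_transpose.matrix_mulVec continuous_const
  have h6 := h5.dotProduct (continuous_snd.matrix_mulVec h5)
  exact Complex.continuous_exp.comp (Complex.continuous_ofReal.comp (h6.div_const 2)).neg

/-- The normal law with covariance `H V Hᵀ` depends continuously on `H` and `V`, the limit being the
image under `H'` of the normal law with covariance `V'`. -/
lemma tendsto_normalLaw {p : ℕ} {κ : Type*} [Fintype κ] [DecidableEq κ]
    {H : ℕ → Matrix (Pos p ⊕ Fin p) κ ℝ}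
    {V : ℕ → Matrix κ κ ℝ} {H' : Matrix (Pos p ⊕ Fin p) κ ℝ} {V' : Matrix κ κ ℝ}
    (hV : ∀ n, (V n).PosSemidef) (hV' : V'.PosSemidef) (hH : Tendsto H atTop (𝓝 H'))
    (h : Tendsto V atTop (𝓝 V')) {μ : ProbabilityMeasure (VecDiag p)}
    (hμ : (μ : Measure (VecDiag p)) = (multivariateGaussian 0 V').map
        (LinearMap.toContinuousLinearMap (Matrix.toEuclideanLin H'))) :
    Tendsto (fun n => normalLaw (H n * V n * (H n)ᵀ)) atTop (𝓝 μ) := by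
  refine ProbabilityMeasure.tendsto_iff_tendsto_charFun.2 fun a => ?_
  have h1 : Tendsto (fun n => charFun (multivariateGaussian 0 (H n * V n * (H n)ᵀ)) a) atTop
      (𝓝 (charFun (μ : Measure (VecDiag p)) a)) := by
    simp only [hμ, charFun_map_multivariateGaussian hV',
      charFun_multivariateGaussian_mul_mul_transpose (hV _)]
    have h2 := ((continuous_exp_quadratic a.ofLp).tendsto (H', V')).comp (hH.prodMk_nhds h)
    exact h2
  exact h1

end NormalLaws

section Population

open Matrix

variable {Ω : Type*} [MeasurableSpace Ω] {P : Measure Ω} {d p n : ℕ}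
  {Z : Fin p → Loc d → Ω → ℝ} {s : Fin n → Loc d} {f : Loc d → ℝ} {Om : Matrix (Fin p) (Fin p) ℝ}

lemma lamPop_eq_latentLam (hOm : IsUnit Om.det)
    (h : popCov P s f (mix Om Z) = Om * diagonal (latentLam P s f Z) * Omᵀ) :
    lamPop P s f Om Z = latentLam P s f Z := by
  ext i
  rw [lamPop, h, inv_mul_mul_inv_transpose hOm, diagonal_apply_eq]

/-- When the population eigenvalues are distinct, `Λ(f)` is the matrix of these eigenvalues. -/
lemma eq_diagonal_latentLam {Gam L : Matrix (Fin p) (Fin p) ℝ} (hOm : IsUnit Om.det)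
    (h0 : popCov P s (kernelZero d) (mix Om Z) = Om * Omᵀ)
    (h1 : popCov P s f (mix Om Z) = Om * diagonal (latentLam P s f Z) * Omᵀ)
    (hlam : StrictAnti (latentLam P s f Z))
    (h : IsUnmixing (popCov P s (kernelZero d) (mix Om Z)) (popCov P s f (mix Om Z)) Gam L) :
    L = diagonal (latentLam P s f Z) := by
  have h2 := h.congr_basis (Matrix.mul_nonsing_inv Om hOm)
  rw [h0, h1, inv_mul_mul_inv_transpose hOm, ← Matrix.mul_one Om,
    Matrix.mul_assoc Om 1, Matrix.one_mul, Matrix.mul_one] at h2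
  have h3 := inv_mul_mul_inv_transpose hOm (1 : Matrix (Fin p) (Fin p) ℝ)
  rw [Matrix.mul_one] at h3
  rw [h3] at h2
  exact (h2.apply_of_one hlam).2.1

lemma covF_eq : covF P s f Om Z = (mBar Om⁻¹ * gMat (lamPop P s f Om Z)) *
    vMat (latentCov P s Z) s (kernelZero d) f * (mBar Om⁻¹ * gMat (lamPop P s f Om Z))ᵀ := by
  rw [covF, transpose_mul]
  simp only [Matrix.mul_assoc]

lemma aemeasurable_scaledVecDiag (hgauss : ∀ k, IsGaussianProcess (Z k) P)
    {gam lam : Matrix (Fin p) (Fin p) ℝ → Matrix (Fin p) (Fin p) ℝ → Matrix (Fin p) (Fin p) ℝ}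
    (hgam : MatMeasurable gam) (hlam : MatMeasurable lam) (G L : Matrix (Fin p) (Fin p) ℝ) :
    AEMeasurable (fun ω => scaledVecDiag n
      (gam (empCov s (kernelZero d) (mix Om Z) ω) (empCov s f (mix Om Z) ω) - G)
      (lam (empCov s (kernelZero d) (mix Om Z) ω) (empCov s f (mix Om Z) ω) - L)) P := by
  have hZ : ∀ k x, AEMeasurable (Z k x) P := fun k x => (hgauss k).aemeasurable x
  have hemp : ∀ g : Loc d → ℝ, AEMeasurable
      (fun ω (i j : Fin p) => empCov s g (mix Om Z) ω i j) P := by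
    intro g
    refine aemeasurable_pi_lambda _ fun i => aemeasurable_pi_lambda _ fun j => ?_
    simp only [empCov_mix, Matrix.mul_apply]
    refine Finset.aemeasurable_fun_sum _ fun a _ => AEMeasurable.mul_const ?_ _
    exact Finset.aemeasurable_fun_sum _ fun b _ =>
      (aemeasurable_latentEmp hgauss _ _).const_mul _
  have hq := (hemp (kernelZero d)).prodMk (hemp f)
  have h1 := hgam.comp_aemeasurable hq
  have h2 := hlam.comp_aemeasurable hq
  have h3 : ∀ i j, AEMeasurable (fun ω => gam (empCov s (kernelZero d) (mix Om Z) ω)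
      (empCov s f (mix Om Z) ω) i j) P := fun i j =>
    (aemeasurable_pi_iff.1 (aemeasurable_pi_iff.1 h1 i)) j
  have h4 : ∀ i j, AEMeasurable (fun ω => lam (empCov s (kernelZero d) (mix Om Z) ω)
      (empCov s f (mix Om Z) ω) i j) P := fun i j =>
    (aemeasurable_pi_iff.1 (aemeasurable_pi_iff.1 h2 i)) j
  refine (by fun_prop : Measurable (WithLp.toLp 2 : (Pos p ⊕ Fin p → ℝ) → _)).comp_aemeasurable
    (aemeasurable_pi_lambda _ fun c => ?_)
  rcases c with c | c
  · exact ((h3 c.1 c.2).sub_const _).const_mul _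
  · exact ((h4 c c).sub_const _).const_mul _

end Population

end SpatialBSS

open SpatialBSS Matrix

theorem proposition4 {Ω : Type*} [MeasurableSpace Ω] (P : Measure Ω) [IsProbabilityMeasure P]
    (d p : ℕ)
    -- the latent field `Z = (Z₁, …, Z_p)` on `ℝ^d` and the covariance functions `K₁, …, K_p`
    (Z : Fin p → SpatialBSS.Loc d → Ω → ℝ) (K : Fin p → SpatialBSS.Loc d → ℝ)
    (hmean : ∀ k x, ∫ ω, Z k x ω ∂P = 0)
    (hunit : ∀ k l x, cov[Z k x, Z l x; P] = if k = l then 1 else 0)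
    (hcov : ∀ k l x y, cov[Z k x, Z l y; P] = if k = l then K k (x - y) else 0)
    (hgauss : ∀ k, IsGaussianProcess (Z k) P)
    (hindep : iIndepFun (fun (k : Fin p) (ω : Ω) (x : SpatialBSS.Loc d) => Z k x ω) P)
    -- the mixing matrix
    (Om : Matrix (Fin p) (Fin p) ℝ) (hOm : IsUnit Om.det)
    -- the observation points: for each `n`, the points `s n 1, …, s n n`
    (s : (n : ℕ) → Fin n → SpatialBSS.Loc d)
    (Δ : ℝ) (hΔ : 0 < Δ) (hsep : ∀ n (i j : Fin n), i ≠ j → Δ ≤ ‖s n i - s n j‖)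
    -- the kernel and the decay conditions
    (f : SpatialBSS.Loc d → ℝ) (A α : ℝ) (hA : 0 < A) (hα : 0 < α)
    (hK : ∀ k x, |K k x| ≤ A / (1 + ‖x‖ ^ ((d : ℝ) + α)))
    (hf : ∀ x, |f x| ≤ A / (1 + ‖x‖ ^ ((d : ℝ) + α)))
    (hfsymm : ∀ n (i j : Fin n), f (s n i - s n j) = f (s n j - s n i))
    -- asymptotic separation of the diagonal elements of `Ω⁻¹ M(f) Ω⁻ᵀ`
    (hgap : 0 < liminf (fun n : ℕ => ⨅ (i : Fin p) (j : Fin p) (_ : (i : ℕ) + 1 = (j : ℕ)),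
      ((SpatialBSS.lamPop P (s n) f Om Z i - SpatialBSS.lamPop P (s n) f Om Z j : ℝ) : EReal))
      atTop)
    -- `Λ(f)`, for each `n ≥ 1`
    (Lam : ℕ → Matrix (Fin p) (Fin p) ℝ)
    (hLam : ∀ n, 1 ≤ n → ∃ Gam : Matrix (Fin p) (Fin p) ℝ,
      SpatialBSS.IsUnmixing
        (SpatialBSS.popCov P (s n) (SpatialBSS.kernelZero d) (SpatialBSS.mix Om Z))
        (SpatialBSS.popCov P (s n) f (SpatialBSS.mix Om Z)) Gam (Lam n)) :
    -- the estimators, as measurable functions of the two empirical matrices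
    ∃ gam lam : ℕ → Matrix (Fin p) (Fin p) ℝ → Matrix (Fin p) (Fin p) ℝ →
        Matrix (Fin p) (Fin p) ℝ,
      (∀ n, SpatialBSS.MatMeasurable (gam n) ∧ SpatialBSS.MatMeasurable (lam n)) ∧
      -- they diagonalise jointly whenever this is possible
      (∀ n M₀ M, (∃ Γ Λ, SpatialBSS.IsUnmixing M₀ M Γ Λ) →
        SpatialBSS.IsUnmixing M₀ M (gam n M₀ M) (lam n M₀ M)) ∧
      -- which has probability going to one for the empirical matrices
      Tendsto (fun n => P {ω | ∃ Γ Λ, SpatialBSS.IsUnmixing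
          (SpatialBSS.empCov (s n) (SpatialBSS.kernelZero d) (SpatialBSS.mix Om Z) ω)
          (SpatialBSS.empCov (s n) f (SpatialBSS.mix Om Z) ω) Γ Λ}) atTop (𝓝 1) ∧
      (∀ n, (SpatialBSS.covF P (s n) f Om Z).PosSemidef) ∧
      -- `Q n` is the law of the normalised estimation error
      ∃ Q : ℕ → ProbabilityMeasure (SpatialBSS.VecDiag p),
        (∀ n, (Q n : Measure (SpatialBSS.VecDiag p)) = P.map (fun ω =>
          SpatialBSS.scaledVecDiag n
            (gam n (SpatialBSS.empCov (s n) (SpatialBSS.kernelZero d) (SpatialBSS.mix Om Z) ω)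
              (SpatialBSS.empCov (s n) f (SpatialBSS.mix Om Z) ω) - Om⁻¹)
            (lam n (SpatialBSS.empCov (s n) (SpatialBSS.kernelZero d) (SpatialBSS.mix Om Z) ω)
              (SpatialBSS.empCov (s n) f (SpatialBSS.mix Om Z) ω) - Lam n))) ∧
        SpatialBSS.AsympClose Q
          (fun n => SpatialBSS.normalLaw (SpatialBSS.covF P (s n) f Om Z)) := by

  have hcov0 : ∀ k l x y, k ≠ l → cov[Z k x, Z l y; P] = 0 := fun k l x y h => by
    rw [hcov, if_neg h]
  have hr : 0 < (d : ℝ) + α := by positivity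
  have hinj : ∀ n, Function.Injective (s n) := by
    intro n i j hij
    by_contra hne
    have := hsep n i j hne
    rw [hij, sub_self, norm_zero] at this
    linarith
  have h0symm : ∀ n (i j : Fin n), kernelZero d (s n i - s n j) = kernelZero d (s n j - s n i) :=
    fun n i j => kernelZero_sub_comm _ _
  -- uniform bounds in `n`; the maximum with `0` covers the case without points
  obtain ⟨C₀, hC₀⟩ := exists_sum_inv_one_add_norm_rpow_le d hΔ hα
  have hsum : ∀ n (i : Fin n), ∑ j, (1 + ‖s n i - s n j‖ ^ ((d : ℝ) + α))⁻¹ ≤ max C₀ 0 :=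
    fun n i => (hC₀ n (s n) (hsep n) i).trans (le_max_left _ _)
  have hB := fun n => norm_latentCov_le hA.le hcov hK (hsum n) (le_max_right _ _)
  have hC := fun n (c : Pos p ⊕ Pos p) =>
    norm_pairT_le hA.le hr hf (hsum n) (le_max_right _ _) c
  have hpsd : ∀ n, (vMat (latentCov P (s n) Z) (s n) (kernelZero d) f).PosSemidef := fun n =>
    posSemidef_vMat (posSemidef_latentCov hgauss _) (h0symm n) (hfsymm n)
  have hlam0 : ∀ n, 1 ≤ n → latentLam P (s n) (kernelZero d) Z = fun _ => 1 := fun n hn =>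
    latentLam_kernelZero (fun k x => by rw [hunit, if_pos rfl]) hn (hinj n)
  have hpop := fun n (g : Loc d → ℝ) => popCov_mix hmean hgauss hcov0 Om (s n) g
  have hlamPop : ∀ n, lamPop P (s n) f Om Z = latentLam P (s n) f Z := fun n =>
    lamPop_eq_latentLam hOm (hpop n f)
  simp only [hlamPop] at hgap
  obtain ⟨ε, hε, hgap⟩ := exists_eventually_gap hgap
  have hLam' : ∀ᶠ n in atTop, Lam n = Matrix.diagonal (latentLam P (s n) f Z) := by
    filter_upwards [hgap, eventually_ge_atTop 1] with n hn hn1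
    obtain ⟨Gam, hGam⟩ := hLam n hn1
    refine eq_diagonal_latentLam hOm ?_ (hpop n f) (strictAnti_of_gap hε hn) hGam
    rw [hpop, hlam0 n hn1, Matrix.diagonal_one, Matrix.mul_one]
  -- the estimators are one Borel function of the two matrices, the same for all `n`; the signs of
  -- the rows of `Γ` are fixed by requiring `Γ Ω` to have a nonnegative diagonal
  obtain ⟨gam, lam, hgam, hlam, hsel⟩ := exists_measurable_isUnmixing Om
  have he : ∀ n, AEMeasurable (errVec P (s n) (kernelZero d) f Z) P := fun n =>
    aemeasurable_errVec hgauss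
  have hY := fun n => aemeasurable_scaledVecDiag (n := n) (s := s n) (f := f) (Om := Om) hgauss
    hgam hlam Om⁻¹ (Lam n)
  let Q : ℕ → ProbabilityMeasure (VecDiag p) := fun n =>
    ⟨_, Measure.isProbabilityMeasure_map (hY n)⟩
  -- convergence of the normalised errors of the latent field along a further subsequence
  have key : ∀ ns : ℕ → ℕ, Tendsto ns atTop atTop → ∃ φ : ℕ → ℕ, StrictMono φ ∧
      ∃ lam' V', StrictAnti lam' ∧ V'.PosSemidef ∧
      Tendsto (fun m => latentLam P (s (ns (φ m))) f Z) atTop (𝓝 lam') ∧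
      Tendsto (fun m => vMat (latentCov P (s (ns (φ m))) Z) (s (ns (φ m))) (kernelZero d) f) atTop
        (𝓝 V') ∧
      ∀ a, Tendsto (fun m => charFun (P.map (errVec P (s (ns (φ m))) (kernelZero d) f Z)) a) atTop
        (𝓝 (charFun (multivariateGaussian 0 V') a)) := by
    intro ns hns
    obtain ⟨φ, hφ, lam', V', h1, h2, h3, h4⟩ := exists_subseq_tendsto hε hgap
      (fun n k => abs_latentLam_le hcov0 (hfsymm n) (hB n) (hC n) k)
      (fun n c c' => abs_vMat_le (hB n) (hC n) c c') hpsd hns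
    refine ⟨φ, hφ, lam', V', h1, h2, h3, h4, fun a => ?_⟩
    have h5 := (tendsto_charFun_errVec_sub hmean hgauss hindep hcov0 h0symm hfsymm hB hC a).comp
      (hns.comp hφ.tendsto_atTop)
    have h6 : Tendsto (fun m => Complex.exp (-(a.ofLp ⬝ᵥ
        vMat (latentCov P (s (ns (φ m))) Z) (s (ns (φ m))) (kernelZero d) f *ᵥ a.ofLp / 2 : ℝ)))
        atTop (𝓝 (charFun (multivariateGaussian 0 V') a)) := by
      have h7 : charFun (multivariateGaussian 0 V') a =
          Complex.exp (-(a.ofLp ⬝ᵥ V' *ᵥ a.ofLp / 2 : ℝ)) := by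
        have := charFun_multivariateGaussian_mul_mul_transpose h2 1 a
        simpa only [Matrix.one_mul, Matrix.mul_one, Matrix.transpose_one, Matrix.one_mulVec]
          using this
      rw [h7]
      have h8 := ((continuous_exp_quadratic a.ofLp).tendsto
        ((1 : Matrix (Pos p ⊕ Pos p) (Pos p ⊕ Pos p) ℝ), V')).comp
        (tendsto_const_nhds.prodMk_nhds h4)
      simpa only [Function.comp_def, Matrix.transpose_one, Matrix.one_mulVec] using h8
    simpa using h5.add h6
  have hH : ∀ n, covF P (s n) f Om Z = (mBar Om⁻¹ * gMat (latentLam P (s n) f Z)) *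
      vMat (latentCov P (s n) Z) (s n) (kernelZero d) f *
        (mBar Om⁻¹ * gMat (latentLam P (s n) f Z)).transpose := fun n => by
    rw [covF_eq, hlamPop]
  refine ⟨fun _ => gam, fun _ => lam, fun _ => ⟨hgam, hlam⟩, fun _ M₀ M h => (hsel M₀ M h).1, ?_,
    fun n => ?_, Q, fun n => rfl, fun dw hdw => ?_⟩
  · refine tendsto_of_subseq_tendsto fun ns hns => ?_
    obtain ⟨φ, hφ, lam', V', -, -, -, -, h5⟩ := key ns hns
    refine ⟨φ, tendsto_measure_one (fun m => he _) h5 fun R => ?_⟩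
    filter_upwards [(hns.comp hφ.tendsto_atTop).eventually
      (eventually_exists_isUnmixing hOm hfsymm hlam0 R)] with m hm
    exact hm
  · rw [hH]
    simpa using (hpsd n).mul_mul_conjTranspose_same
      (mBar Om⁻¹ * gMat (latentLam P (s n) f Z))
  · refine tendsto_of_subseq_tendsto fun ns hns => ?_
    obtain ⟨φ, hφ, lam', V', h1, h2, h3, h4, h5⟩ := key ns hns
    have hν := hns.comp hφ.tendsto_atTop
    refine ⟨φ, tendsto_dist_of_tendsto dw hdw (tendsto_law_of_linearisation (fun m => he _) h5
      (fun m => hY (ns (φ m)))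
      (LinearMap.toContinuousLinearMap (Matrix.toEuclideanLin (mBar Om⁻¹ * gMat lam')))
      fun R η hη => eventually_norm_scaledVecDiag_sub_le hOm hfsymm hlam0 hsel hLam' hν h1 h3 hη)
      ?_⟩
    simp only [hH]
    exact tendsto_normalLaw (fun m => hpsd _) h2 (tendsto_mBar_mul_gMat Om⁻¹ h1 h3) h4 rfl
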